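/- **Setting.** Let $\mathcal T$ be the set of planar rooted trees, finite or infinite, with all vertex degrees finite and with root $r$ of degree $1$. Write $|G|$ for the number of edges of a graph $G$, $\sigma_v$ for the degree of a vertex $v$, and $\mathcal T_N=\{T\in\mathcal T:|T|=N\}$. Let $w_n\ge 0$ $(n\ge 1)$ be branching weights with $w_1>0$ and $w_n>0$ for some $n\ge 3$. Put $$Z_N=\sum_{T\in\mathcal T_N}\ \prod_{v\in T\setminus r}w_{\sigma_v},\qquad \phi(z)=\sum_{n\ge1}w_nz^{n-1},\qquad Z(\zeta)=\sum_{N\ge1}Z_N\zeta^N,$$ let $z_c$ and $\zeta_0$ be the radii of convergence of $\phi$ and $Z$, and assume that $z_c>0$ and that the weights are generic, i.e. $\lim_{\zeta\uparrow\zeta_0}Z(\zeta)<z_c$. For $Z_N\neq0$ let $\nu_N$ be the probability distribution $\nu_N(T)=Z_N^{-1}\prod_{v\in T\setminus r}w_{\sigma_v}$ on $\mathcal T_N$. Let $\nu$ be the limit of $\nu_N$ as $N\to\infty$ (along the $N$ with $Z_N\ne0$), i.e. the Borel probability measure on $\mathcal T$ with $$\nu(\{T':B_R(T')=B_R(T)\})=\lim_{N\to\infty}\nu_N(\{T':B_R(T')=B_R(T)\})\quad\text{for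 all } R\ge1,\ T\in\mathcal T,$$ where $B_R(T)$ is the ball of radius $R$ around the root and the Borel sets are those generated by the sets $\{T':B_R(T')=B_R(T)\}$. A *spine* of $T$ is an infinite non-backtracking path $s_0=r,s_1,s_2,\dots$ in $T$ starting at the root. Given a spine and $K\ge1$, let $G_0^K$ be the subtree of $T$ spanned by $s_1,\dots,s_K$ and the vertices of the branches attached to the spine at $s_1,\dots,s_K$; that is, by all vertices that are equal to or descend from $s_i$, but not from or equal to $s_{i+1}$, for some $1\le i\le K$. Let $\bar G_0^K$ be its closure, i.e. the subgraph of $T$ spanned by the vertices of $G_0^K$ and all vertices with a neighbour in $G_0^K$. **Lemma 2.** $\nu$-almost every $T$ has exactly one spine, so that $G_0^K$ is $\nu$-almost surely well defined, and there exist constants $\bar c>0$ and $u_0>0$ (depending only on the weights) such that for all integers $K\ge1$ and all real $u>u_0$ $$\nu\left(\left\{T:\ K^{-2}\,|\bar G_0^K|\ge u\right\}\right)\ \le\ \frac{\bar c}{\sqrt u}.$$ -/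

import Mathlib

open Filter Topology MeasureTheory
open scoped ENNReal

/-- The outer boundary of a vertex set `V₀`: the vertices outside `V₀` with a neighbour in `V₀`. -/
def SimpleGraph.outerBoundary {V : Type*} (G : SimpleGraph V) (V₀ : Set V) : Set V :=
  {v | v ∉ V₀ ∧ ∃ u ∈ V₀, G.Adj u v}

/-- The size (number of edges, possibly `∞`) of the closure of the subgraph of `G` spanned by `V₀`,
the closure being the subgraph spanned by `V₀` together with its outer boundary. -/
noncomputable def SimpleGraph.closureSize {V : Type*} (G : SimpleGraph V) (V₀ : Set V) : ℕ∞ :=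
  (G.induce (V₀ ∪ G.outerBoundary V₀)).edgeSet.encard

/-- Planar rooted trees (finite or infinite), locally finite, with a root of degree one, as
combinatorial objects: a vertex is the list of the positions (`0` is leftmost) of the successive
children on the way from the root `[]` to it, so `v ++ [i]` is the `i`-th child of `v`. -/
@[ext]
structure PlanarTree where
  /-- the set of vertices -/
  verts : Set (List ℕ)
  root_mem : [] ∈ verts
  root_degree_one : ∀ i : ℕ, [i] ∈ verts ↔ i = 0
  parent_mem : ∀ (v : List ℕ) (i : ℕ), v ++ [i] ∈ verts → v ∈ verts
  left_sibling_mem : ∀ (v : List ℕ) (i j : ℕ), i < j → v ++ [j] ∈ verts → v ++ [i] ∈ verts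
  locally_finite : ∀ v : List ℕ, {i : ℕ | v ++ [i] ∈ verts}.Finite

namespace PlanarTree

/-- The root `r`. -/
def root (T : PlanarTree) : T.verts := ⟨[], T.root_mem⟩

/-- The underlying graph: every vertex is joined to its children. -/
def graph (T : PlanarTree) : SimpleGraph T.verts where
  Adj u v := (∃ i : ℕ, v.1 = u.1 ++ [i]) ∨ (∃ i : ℕ, u.1 = v.1 ++ [i])
  symm := ⟨fun _ _ h => h.symm⟩
  loopless := ⟨fun u h => by rcases h with ⟨i, h⟩ | ⟨i, h⟩ <;> simpa using congrArg List.length h⟩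

/-- The degree `σ_v` of a vertex. -/
noncomputable def degree (T : PlanarTree) (v : T.verts) : ℕ := (T.graph.neighborSet v).ncard

/-- The size `|T|`: the number of edges, possibly `∞`. -/
noncomputable def size (T : PlanarTree) : ℕ∞ := T.graph.edgeSet.encard

/-- The set `𝒯_N` of trees of size `N`. -/
def ofSize (N : ℕ) : Set PlanarTree := {T | T.size = N}

/-- The set of trees that coincide with `T` up to height `R`, i.e. whose ball of radius `R` around
the root is that of `T`. -/
def ball (R : ℕ) (T : PlanarTree) : Set PlanarTree :=
  {T' | ∀ v : List ℕ, v.length ≤ R → (v ∈ T'.verts ↔ v ∈ T.verts)}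

/-- The Borel `σ`-algebra of the metric `d(T, T') = 1 / R`, with `R` the largest radius such that
the balls of radius `R` around the roots of `T` and `T'` coincide. The sets `ball R T` with `R ≥ 1`
are countably many and form a base of the topology, so they generate this `σ`-algebra. -/
instance : MeasurableSpace PlanarTree :=
  MeasurableSpace.generateFrom {A | ∃ (R : ℕ) (T : PlanarTree), 1 ≤ R ∧ A = ball R T}

/-- The weight `∏_{v ∈ T ∖ r} w_{σ_v}` of a finite tree. -/
noncomputable def weight (w : ℕ → ℝ) (T : PlanarTree) : ℝ :=
  ∏ᶠ (v : T.verts) (_ : v ≠ T.root), w (T.degree v)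

/-- The finite volume partition function `Z_N` (a finite sum). -/
noncomputable def partitionFunction (w : ℕ → ℝ) (N : ℕ) : ℝ :=
  ∑ᶠ T ∈ ofSize N, weight w T

/-- `ν_N(A)` for the probability distribution `ν_N(T) = Z_N⁻¹ ∏_{v ∈ T ∖ r} w_{σ_v}` on `𝒯_N`
(meaningful when `Z_N ≠ 0`). -/
noncomputable def finiteVolumeProb (w : ℕ → ℝ) (N : ℕ) (A : Set PlanarTree) : ℝ :=
  ∑ᶠ T ∈ ofSize N ∩ A, (partitionFunction w N)⁻¹ * weight w T

/-- The radius of convergence of the power series `∑_n a_n z^n`. -/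
noncomputable def convergenceRadius (a : ℕ → ℝ) : ℝ≥0∞ :=
  (FormalMultilinearSeries.ofScalars (𝕜 := ℝ) ℝ a).radius

/-- `z_c`, the radius of convergence of `φ(z) = ∑_{n ≥ 1} w_n z^{n-1}`. -/
noncomputable def zCrit (w : ℕ → ℝ) : ℝ≥0∞ := convergenceRadius fun n => w (n + 1)

/-- `ζ_0`, the radius of convergence of `Z(ζ) = ∑_{N ≥ 1} Z_N ζ^N` (note that `Z_0 = 0` as a
coefficient, no tree having size zero). -/
noncomputable def zetaCrit (w : ℕ → ℝ) : ℝ≥0∞ := convergenceRadius (partitionFunction w)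

/-- The generating function `Z(ζ) = ∑_{N ≥ 1} Z_N ζ^N`. -/
noncomputable def genFun (w : ℕ → ℝ) (ζ : ℝ) : ℝ := ∑' N : ℕ, partitionFunction w N * ζ ^ N

/-- Branching weights `w_1, w_2, …` of a generic ensemble (the value `w 0` plays no role):
nonnegative, `w_1 > 0`, `w_n > 0` for some `n ≥ 3`, `z_c > 0`, and the limit
`lim_{ζ ↑ ζ_0} Z(ζ)` is strictly smaller than `z_c`. -/
structure IsGeneric (w : ℕ → ℝ) : Prop where
  nonneg : ∀ n, 1 ≤ n → 0 ≤ w n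
  one_pos : 0 < w 1
  branching : ∃ n, 3 ≤ n ∧ 0 < w n
  zCrit_pos : 0 < zCrit w
  generic : ∃ Z₀ : ℝ, Tendsto (genFun w) (𝓝[<] (zetaCrit w).toReal) (𝓝 Z₀) ∧
    ENNReal.ofReal Z₀ < zCrit w

/-- `ν` is the limit of the distributions `ν_N`, as `N → ∞` along the `N` with `Z_N ≠ 0`: the
probability measure on trees with `ν(𝓑) = lim ν_N(𝓑)` for every ball `𝓑` of the space of trees. -/
structure IsInfiniteVolumeLimit (w : ℕ → ℝ) (ν : Measure PlanarTree) : Prop where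
  isProbabilityMeasure : IsProbabilityMeasure ν
  tendsto_ball : ∀ (R : ℕ) (T : PlanarTree), 1 ≤ R →
    Tendsto (fun N => finiteVolumeProb w N (ball R T))
      (atTop ⊓ 𝓟 {N | partitionFunction w N ≠ 0}) (𝓝 (ν.real (ball R T)))

/-- A spine `s_0 = r, s_1, s_2, …`: an infinite non-backtracking path starting at the root. -/
def IsSpine (T : PlanarTree) (s : ℕ → T.verts) : Prop :=
  s 0 = T.root ∧ (∀ n, T.graph.Adj (s n) (s (n + 1))) ∧ ∀ n, s (n + 2) ≠ s n

/-- The vertices of the branches at the spine vertex `s_i` (`i ≥ 1`), with `s_i` itself: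
`s_i` and its descendants, except `s_{i+1}` and the descendants of `s_{i+1}`. -/
def branchVerts (T : PlanarTree) (s : ℕ → T.verts) (i : ℕ) : Set T.verts :=
  {v | (s i).1 <+: v.1 ∧ ¬ (s (i + 1)).1 <+: v.1}

/-- The vertex set of `G_0^K`, the subtree spanned by the branches at `s_1, …, s_K`. -/
def truncationVerts (T : PlanarTree) (s : ℕ → T.verts) (K : ℕ) : Set T.verts :=
  ⋃ i ∈ Set.Icc 1 K, T.branchVerts s i

/-- The size of the closure of `G_0^K`. -/
noncomputable def truncationClosureSize (T : PlanarTree) (s : ℕ → T.verts) (K : ℕ) : ℕ∞ :=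
  T.graph.closureSize (T.truncationVerts s K)

end PlanarTree

/-!
The limit `ν` is the law of a tree with one infinite spine, whose vertices have independent
size-biased degrees and carry independent finite critical branches; the proof identifies `ν` on
enough events to read off both assertions.

The events are the sets `p.completions`, where `p` is a finite tree `τ` with a marked leaf: they
consist of the trees that differ from `τ` only in that the marked leaf may have descendants.
Grafting a tree onto the marked leaf gives `ν_N(p.completions) = (weight τ / w₁) Z_{N - m} / Z_N`
with `m = |τ| - 1`. The complement of `p.completions` is a countable disjoint union of balls, so
that the convergence of `ν_N` on balls to a probability measure bounds the upper limit of these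
numbers by `ν(p.completions)`. If `ν(p.completions)` were smaller than
`mass p = (weight τ / w₁) ζ₀ ^ m`,
then `Z_N ζ₀ ^ N` would be unbounded, contradicting `Z(ζ₀) < ∞`
(`MarkedTree.mass_le_measure_completions`). No asymptotics of `Z_N` are needed.

Without the factors of the mark, the generating function of the trees with a mark at height `K + 1`
is `(ζ φ'(Z(ζ))) ^ K` (`MarkedTree.tsum_mass`). At `ζ₀` it is at least `1`: otherwise `ζ φ(z) ≤ z`
would have a finite solution for some `ζ > ζ₀`, here `Z(ζ₀) < z_c` is used, and every solution of
this inequality bounds `Z(ζ)` (`PlanarTree.one_le_zetaCrit_mul_branchDerivSum`). On infinite trees,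
and `ν`-almost every tree is infinite, the events with marks at the same height are disjoint. The
lower bounds thus add up to at least `1`, so all of them are equalities
(`MarkedTree.measure_completions`), and almost every tree lies in one of the events for each height.
The marked leaves form the spine, and the branches at its first `K` vertices, with the closure, form
the finite tree `τ`.

The event to be estimated is therefore that the tree `τ` with a mark at height `K + 1` is large. Its
generating function at `x ζ₀` is `(x ζ₀ φ'(Z(x ζ₀))) ^ K`. By strict convexity of `φ`,
`Z(ζ₀) - Z(x ζ₀)` is at most of order `√(1 - x)`, and so `1 - x ζ₀ φ'(Z(x ζ₀))` is too
(`PlanarTree.exists_one_le_mul_branchDerivSum_add`). The choice `x = 1 - 1 / n` with `n` of order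
`u K ^ 2` bounds the probability by a multiple of `K / √n`, that is, of `1 / √u`.
-/

/-! ### Trees without their root -/

namespace PlanarTree

/-- The vertices other than the root, each coded by its path from the unique child `[0]` of the
root. -/
def body (T : PlanarTree) : Set (List ℕ) := {v | 0 :: v ∈ T.verts}

theorem nil_mem_body (T : PlanarTree) : [] ∈ T.body := (T.root_degree_one 0).2 rfl

theorem mem_body_of_append_singleton {T : PlanarTree} {v : List ℕ} {i : ℕ}
    (h : v ++ [i] ∈ T.body) : v ∈ T.body := T.parent_mem (0 :: v) i h

theorem mem_body_of_append {T : PlanarTree} {u v : List ℕ} (h : u ++ v ∈ T.body) :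
    u ∈ T.body := by
  induction v using List.reverseRecOn with
  | nil => simpa using h
  | append_singleton v i ih =>
    exact ih (mem_body_of_append_singleton (i := i) (by simpa using h))

theorem mem_verts_of_append {T : PlanarTree} {u v : List ℕ} (h : u ++ v ∈ T.verts) :
    u ∈ T.verts := by
  induction v using List.reverseRecOn with
  | nil => simpa using h
  | append_singleton v i ih => exact ih (T.parent_mem _ i (by simpa using h))

theorem mem_verts_iff {T : PlanarTree} {v : List ℕ} :
    v ∈ T.verts ↔ v = [] ∨ ∃ u ∈ T.body, v = 0 :: u := by
  constructor
  · intro h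
    rcases v with _ | ⟨a, u⟩
    · exact Or.inl rfl
    · have ha : a = 0 := (T.root_degree_one a).1 (mem_verts_of_append (v := u) (by simpa using h))
      subst ha
      exact Or.inr ⟨u, h, rfl⟩
  · rintro (rfl | ⟨u, hu, rfl⟩)
    · exact T.root_mem
    · exact hu

theorem body_injective : Function.Injective body := by
  intro T T' h
  ext v
  rw [mem_verts_iff, mem_verts_iff, h]

/-- The planar tree with a prescribed set of vertices other than the root. -/
def ofBody (B : Set (List ℕ)) (nil_mem : [] ∈ B)
    (parent : ∀ (v : List ℕ) (i : ℕ), v ++ [i] ∈ B → v ∈ B)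
    (left : ∀ (v : List ℕ) (i j : ℕ), i < j → v ++ [j] ∈ B → v ++ [i] ∈ B)
    (fin : ∀ v : List ℕ, {i : ℕ | v ++ [i] ∈ B}.Finite) : PlanarTree where
  verts := {v | v = [] ∨ ∃ u ∈ B, v = 0 :: u}
  root_mem := Or.inl rfl
  root_degree_one i := by simp [nil_mem]
  parent_mem v i h := by
    rcases v with _ | ⟨a, v⟩
    · exact Or.inl rfl
    · rcases h with h | ⟨u, hu, h⟩
      · simp at h
      · simp only [List.cons_append, List.cons.injEq] at h
        obtain ⟨rfl, rfl⟩ := h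
        exact Or.inr ⟨v, parent v i hu, rfl⟩
  left_sibling_mem v i j hij h := by
    rcases v with _ | ⟨a, v⟩
    · simp [nil_mem] at h
      omega
    · rcases h with h | ⟨u, hu, h⟩
      · simp at h
      · simp only [List.cons_append, List.cons.injEq] at h
        obtain ⟨rfl, rfl⟩ := h
        exact Or.inr ⟨v ++ [i], left v i j hij hu, rfl⟩
  locally_finite v := by
    rcases v with _ | ⟨a, v⟩
    · refine (Set.finite_singleton 0).subset ?_
      intro i hi
      simpa [nil_mem] using hi
    · refine (fin v).subset ?_
      rintro i (h | ⟨u, hu, h⟩)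
      · simp at h
      · simp only [List.cons_append, List.cons.injEq] at h
        obtain ⟨rfl, rfl⟩ := h
        exact hu

@[simp]
theorem body_ofBody (B : Set (List ℕ)) (h₁ h₂ h₃ h₄) : (ofBody B h₁ h₂ h₃ h₄).body = B := by
  ext v
  simp [body, ofBody]

theorem left_mem_body {T : PlanarTree} {v : List ℕ} {i j : ℕ} (hij : i < j)
    (h : v ++ [j] ∈ T.body) : v ++ [i] ∈ T.body := T.left_sibling_mem (0 :: v) i j hij h

theorem finite_children (T : PlanarTree) (v : List ℕ) : {i : ℕ | v ++ [i] ∈ T.body}.Finite :=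
  T.locally_finite (0 :: v)

/-- The number of children of a vertex other than the root. -/
noncomputable def numChildren (T : PlanarTree) (v : List ℕ) : ℕ := {i : ℕ | v ++ [i] ∈ T.body}.ncard

theorem append_singleton_mem_body {T : PlanarTree} {v : List ℕ} {i : ℕ} :
    v ++ [i] ∈ T.body ↔ i < T.numChildren v := by
  have key : ∀ S : Set ℕ, S.Finite → (∀ i j, i < j → j ∈ S → i ∈ S) → ∀ i, i ∈ S ↔ i < S.ncard := by
    intro S hS hl i
    constructor
    · intro hi
      have : Set.Iic i ⊆ S := fun j hj => by
        rcases eq_or_lt_of_le (Set.mem_Iic.1 hj) with rfl | h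
        · exact hi
        · exact hl j i h hi
      have := Set.ncard_le_ncard this hS
      simp at this
      omega
    · intro hi
      by_contra hn
      have : S ⊆ Set.Iio i := fun j hj => by
        by_contra hji
        rcases eq_or_lt_of_le (not_lt.1 fun h => hji (Set.mem_Iio.2 h)) with rfl | h
        · exact hn hj
        · exact hn (hl _ _ h hj)
      have := Set.ncard_le_ncard this (Set.finite_Iio i)
      simp at this
      omega
  exact key _ (T.finite_children v) (fun i j hij h => left_mem_body hij h) i

theorem numChildren_eq_of_forall {T : PlanarTree} {v : List ℕ} {k : ℕ}
    (h : ∀ i, v ++ [i] ∈ T.body ↔ i < k) : T.numChildren v = k := by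
  have h' : ∀ i, i < T.numChildren v ↔ i < k := fun i => append_singleton_mem_body.symm.trans (h i)
  have h₁ := h' k
  have h₂ := h' (T.numChildren v)
  omega

theorem numChildren_congr {T T' : PlanarTree} {v v' : List ℕ}
    (h : ∀ i, v ++ [i] ∈ T.body ↔ v' ++ [i] ∈ T'.body) : T.numChildren v = T'.numChildren v' :=
  numChildren_eq_of_forall fun i => (h i).trans append_singleton_mem_body

/-- The vertex of the tree coded by an element of the body. -/
def toVert (T : PlanarTree) (v : T.body) : T.verts := ⟨0 :: v.1, v.2⟩

theorem toVert_injective (T : PlanarTree) : Function.Injective T.toVert := fun u v h => by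
  simpa [toVert, Subtype.ext_iff] using h

theorem range_toVert (T : PlanarTree) : Set.range T.toVert = {v | v ≠ T.root} := by
  ext ⟨v, hv⟩
  constructor
  · rintro ⟨u, hu⟩ h
    have := congrArg Subtype.val (hu.trans h)
    simp [toVert, root] at this
  · intro h
    rcases mem_verts_iff.1 hv with rfl | ⟨u, hu, rfl⟩
    · exact absurd rfl h
    · exact ⟨⟨u, hu⟩, rfl⟩

theorem degree_toVert (T : PlanarTree) (v : T.body) :
    T.degree (T.toVert v) = T.numChildren v.1 + 1 := by
  have hp : (0 :: v.1).dropLast ∈ T.verts :=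
    mem_verts_of_append (v := [(0 :: v.1).getLast (by simp)])
      (by rw [List.dropLast_append_getLast]; exact v.2)
  have himg : Subtype.val '' (T.graph.neighborSet (T.toVert v)) =
      insert (0 :: v.1).dropLast ((fun i => 0 :: v.1 ++ [i]) '' {i : ℕ | v.1 ++ [i] ∈ T.body}) := by
    ext x
    constructor
    · rintro ⟨⟨y, hy⟩, (⟨i, hi⟩ | ⟨i, hi⟩), rfl⟩
      · right
        simp only [toVert] at hi
        subst hi
        exact ⟨i, hy, rfl⟩
      · left
        simp only [toVert] at hi
        simp [hi]
    · rintro (rfl | ⟨i, hi, rfl⟩)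
      · refine ⟨⟨_, hp⟩, Or.inr ⟨(0 :: v.1).getLast (by simp), ?_⟩, rfl⟩
        exact (List.dropLast_append_getLast _).symm
      · exact ⟨⟨_, hi⟩, Or.inl ⟨i, rfl⟩, rfl⟩
  have hinj : Function.Injective (fun i : ℕ => 0 :: v.1 ++ [i]) := fun i j h => by simpa using h
  rw [degree, ← Set.ncard_image_of_injective _ Subtype.val_injective, himg,
    Set.ncard_insert_of_notMem _ ((T.finite_children v.1).image _),
    Set.ncard_image_of_injective _ hinj]
  · rfl
  · rintro ⟨i, -, h⟩
    have := congrArg List.length h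
    simp at this
    omega

theorem weight_eq (w : ℕ → ℝ) (T : PlanarTree) :
    T.weight w = ∏ᶠ v ∈ T.body, w (T.numChildren v + 1) := by
  have h : T.weight w = ∏ᶠ v ∈ Set.range T.toVert, w (T.degree v) := by
    rw [weight, range_toVert]
    rfl
  rw [h, finprod_mem_range T.toVert_injective, ← finprod_set_coe_eq_finprod_mem]
  exact finprod_congr fun v => by rw [degree_toVert]

/-- An edge of a tree is coded by its lower end, so the size of a tree is the number of its vertices
other than the root. -/
theorem size_eq (T : PlanarTree) : T.size = T.body.encard := by
  have hp : ∀ v : T.body, (0 :: v.1).dropLast ∈ T.verts := fun v =>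
    mem_verts_of_append (v := [(0 :: v.1).getLast (by simp)])
      (by rw [List.dropLast_append_getLast]; exact v.2)
  let e : T.body → Sym2 T.verts := fun v => s(⟨_, hp v⟩, T.toVert v)
  have he : Function.Injective e := by
    intro u v h
    rcases Sym2.eq_iff.1 h with h | h
    · exact T.toVert_injective h.2
    · have h₁ := congrArg (fun x : T.verts => x.1.length) h.1
      have h₂ := congrArg (fun x : T.verts => x.1.length) h.2
      simp [toVert] at h₁ h₂
      omega
  have hr : T.graph.edgeSet = Set.range e := by
    ext x
    induction x with | _ a b =>
    have key : ∀ a b : T.verts, (∃ i, b.1 = a.1 ++ [i]) → s(a, b) ∈ Set.range e := by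
      rintro ⟨a, ha⟩ ⟨b, hb⟩ ⟨i, hi⟩
      simp only at hi
      rcases mem_verts_iff.1 hb with rfl | ⟨u, hu, rfl⟩
      · simp at hi
      · refine ⟨⟨u, hu⟩, ?_⟩
        simp [e, toVert, hi]
    constructor
    · rintro (h | h)
      · exact key a b h
      · rw [Sym2.eq_swap]; exact key b a h
    · rintro ⟨v, hv⟩
      rw [← hv]
      exact Or.inl ⟨(0 :: v.1).getLast (by simp), (List.dropLast_append_getLast _).symm⟩
  rw [size, hr, ← Set.image_univ, he.encard_image, Set.encard_univ]
  rfl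

/-- The product over all vertices other than the root of a function of the number of children. -/
noncomputable def prodBody {M : Type*} [CommMonoid M] (g : ℕ → M) (T : PlanarTree) : M :=
  ∏ᶠ v ∈ T.body, g (T.numChildren v)

theorem weight_eq_prodBody (w : ℕ → ℝ) (T : PlanarTree) :
    T.weight w = T.prodBody fun n => w (n + 1) := weight_eq w T

theorem prodBody_const {M : Type*} [CommMonoid M] (a : M) (T : PlanarTree) (hT : T.body.Finite) :
    T.prodBody (fun _ => a) = a ^ T.body.ncard := by
  rw [prodBody, finprod_mem_eq_finite_toFinset_prod _ hT, Finset.prod_const,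
    Set.ncard_eq_toFinset_card _ hT]

theorem mem_ofSize {T : PlanarTree} {N : ℕ} : T ∈ ofSize N ↔ T.body.Finite ∧ T.body.ncard = N := by
  rw [ofSize, Set.mem_ofPred_eq, size_eq]
  constructor
  · intro h
    have hf : T.body.Finite := Set.finite_of_encard_eq_coe h
    exact ⟨hf, by rw [Set.ncard, h]; rfl⟩
  · rintro ⟨hf, rfl⟩
    exact hf.cast_ncard_eq.symm

theorem mem_ball_succ {T T' : PlanarTree} {R : ℕ} :
    T' ∈ ball (R + 1) T ↔ ∀ v : List ℕ, v.length ≤ R → (v ∈ T'.body ↔ v ∈ T.body) := by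
  constructor
  · intro h v hv
    exact h (0 :: v) (by simpa using hv)
  · intro h v hv
    rw [mem_verts_iff, mem_verts_iff]
    refine or_congr Iff.rfl (exists_congr fun u => ?_)
    constructor
    · rintro ⟨hu, rfl⟩
      exact ⟨(h u (by simpa using hv)).1 hu, rfl⟩
    · rintro ⟨hu, rfl⟩
      exact ⟨(h u (by simpa using hv)).2 hu, rfl⟩

end PlanarTree

namespace PlanarTree

/-! ### Joining trees at a common vertex -/

/-- The tree in which the child of the root has `k` children, the branches above them being the
trees `f 0, …, f (k - 1)` without their roots. -/
def join (k : ℕ) (f : Fin k → PlanarTree) : PlanarTree :=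
  ofBody {v | v = [] ∨ ∃ i : Fin k, ∃ u ∈ (f i).body, v = i.1 :: u} (Or.inl rfl)
    (by
      rintro v j h
      rcases v with _ | ⟨a, v⟩
      · exact Or.inl rfl
      · rcases h with h | ⟨i, u, hu, h⟩
        · simp at h
        · simp only [List.cons_append, List.cons.injEq] at h
          obtain ⟨rfl, rfl⟩ := h
          exact Or.inr ⟨i, v, mem_body_of_append_singleton hu, rfl⟩)
    (by
      rintro v a b hab h
      rcases v with _ | ⟨c, v⟩
      · rcases h with h | ⟨i, u, hu, h⟩
        · simp at h
        · simp only [List.nil_append, List.cons.injEq] at h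
          exact Or.inr ⟨⟨a, by omega⟩, [], nil_mem_body _, rfl⟩
      · rcases h with h | ⟨i, u, hu, h⟩
        · simp at h
        · simp only [List.cons_append, List.cons.injEq] at h
          obtain ⟨rfl, rfl⟩ := h
          exact Or.inr ⟨i, v ++ [a], left_mem_body hab hu, rfl⟩)
    (by
      rintro v
      rcases v with _ | ⟨c, v⟩
      · refine (Set.finite_Iio k).subset ?_
        rintro j (h | ⟨i, u, hu, h⟩)
        · simp at h
        · simp only [List.nil_append, List.cons.injEq] at h
          simp [h.1]
      · by_cases hc : c < k
        · refine ((f ⟨c, hc⟩).finite_children v).subset ?_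
          rintro j (h | ⟨i, u, hu, h⟩)
          · simp at h
          · simp only [List.cons_append, List.cons.injEq] at h
            obtain ⟨rfl, rfl⟩ := h
            exact hu
        · convert Set.finite_empty
          refine Set.eq_empty_of_forall_notMem ?_
          rintro j (h | ⟨i, u, hu, h⟩)
          · simp at h
          · simp only [List.cons_append, List.cons.injEq] at h
            omega)

theorem body_join (k : ℕ) (f : Fin k → PlanarTree) :
    (join k f).body = {[]} ∪ ⋃ i : Fin k, (fun u => i.1 :: u) '' (f i).body := by
  ext v
  simp only [join, body_ofBody, Set.mem_union, Set.mem_singleton_iff, Set.mem_iUnion, Set.mem_image]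
  refine or_congr Iff.rfl (exists_congr fun i => exists_congr fun u => and_congr Iff.rfl eq_comm)

theorem cons_mem_body_join {k : ℕ} {f : Fin k → PlanarTree} {a : ℕ} {v : List ℕ} :
    a :: v ∈ (join k f).body ↔ ∃ h : a < k, v ∈ (f ⟨a, h⟩).body := by
  rw [body_join]
  simp only [Set.singleton_union, Set.mem_insert_iff, reduceCtorEq, Set.mem_iUnion, Set.mem_image,
    List.cons.injEq, exists_eq_right_right, false_or]
  constructor
  · rintro ⟨i, h, rfl⟩
    exact ⟨i.2, h⟩
  · rintro ⟨h, hv⟩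
    exact ⟨⟨a, h⟩, hv, rfl⟩

theorem coe_cons_mem_body_join {k : ℕ} {f : Fin k → PlanarTree} {i : Fin k} {v : List ℕ} :
    i.1 :: v ∈ (join k f).body ↔ v ∈ (f i).body := by
  rw [cons_mem_body_join]
  exact ⟨fun ⟨_, h⟩ => h, fun h => ⟨i.2, h⟩⟩

theorem numChildren_join_nil (k : ℕ) (f : Fin k → PlanarTree) : (join k f).numChildren [] = k :=
  numChildren_eq_of_forall fun i => by
    rw [List.nil_append, cons_mem_body_join]
    exact ⟨fun ⟨h, _⟩ => h, fun h => ⟨h, nil_mem_body _⟩⟩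

theorem numChildren_join_cons {k : ℕ} (f : Fin k → PlanarTree) (i : Fin k) (v : List ℕ) :
    (join k f).numChildren (i.1 :: v) = (f i).numChildren v :=
  numChildren_congr fun j => by rw [List.cons_append, coe_cons_mem_body_join]

/-- Every tree is obtained by joining trees, in a unique way. -/
theorem join_bijective :
    Function.Bijective fun x : (k : ℕ) × (Fin k → PlanarTree) => join x.1 x.2 := by
  constructor
  · rintro ⟨k, f⟩ ⟨k', f'⟩ h
    simp only at h
    obtain rfl : k = k' := by rw [← numChildren_join_nil k f, h, numChildren_join_nil]
    congr
    funext i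
    refine body_injective (Set.ext fun v => ?_)
    rw [← coe_cons_mem_body_join, h, coe_cons_mem_body_join]
  · intro T
    refine ⟨⟨T.numChildren [], fun i => ofBody {v | i.1 :: v ∈ T.body} ?_ ?_ ?_ ?_⟩, ?_⟩
    · exact append_singleton_mem_body (v := []) |>.2 i.2
    · exact fun v j h => mem_body_of_append_singleton (v := i.1 :: v) h
    · exact fun v a b hab h => left_mem_body (v := i.1 :: v) hab h
    · exact fun v => T.finite_children (i.1 :: v)
    · refine body_injective (Set.ext fun v => ?_)
      rcases v with _ | ⟨a, v⟩
      · exact iff_of_true (nil_mem_body _) (nil_mem_body _)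
      · simp only [cons_mem_body_join, body_ofBody, Set.mem_ofPred_eq, exists_prop,
          and_iff_right_iff_imp]
        exact fun h => append_singleton_mem_body (v := []) |>.1 (mem_body_of_append (v := v) h)

theorem finite_body_join {k : ℕ} {f : Fin k → PlanarTree} :
    (join k f).body.Finite ↔ ∀ i, (f i).body.Finite := by
  rw [body_join]
  constructor
  · intro h i
    refine Set.Finite.of_finite_image (f := fun u => i.1 :: u) (h.subset ?_)
      (List.cons_injective.injOn)
    exact Set.subset_union_of_subset_right
      (Set.subset_iUnion (fun i : Fin k => (fun u => i.1 :: u) '' (f i).body) i) _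
  · intro h
    exact (Set.finite_singleton _).union (Set.finite_iUnion fun i => (h i).image _)

theorem prodBody_join {M : Type*} [CommMonoid M] (g : ℕ → M) {k : ℕ} {f : Fin k → PlanarTree}
    (hf : ∀ i, (f i).body.Finite) : (join k f).prodBody g = g k * ∏ i, (f i).prodBody g := by
  have hfin : ∀ i : Fin k, ((fun u => i.1 :: u) '' (f i).body).Finite := fun i => (hf i).image _
  rw [prodBody, body_join, finprod_mem_union _ (Set.finite_singleton _) (Set.finite_iUnion hfin),
    finprod_mem_singleton, numChildren_join_nil, finprod_mem_iUnion _ hfin,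
    finprod_eq_prod_of_fintype]
  · congr 1
    refine Finset.prod_congr rfl fun i _ => ?_
    rw [finprod_mem_image List.cons_injective.injOn]
    exact finprod_mem_congr rfl fun v _ => by rw [numChildren_join_cons]
  · intro i j hij
    refine Set.disjoint_left.2 ?_
    rintro _ ⟨u, -, rfl⟩ ⟨v, -, h⟩
    simp only [List.cons.injEq] at h
    exact hij (Fin.ext h.1.symm)
  · simp

theorem ncard_body_join {k : ℕ} {f : Fin k → PlanarTree} (hf : ∀ i, (f i).body.Finite) :
    (join k f).body.ncard = 1 + ∑ i, (f i).body.ncard := by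
  have h := prodBody_join (fun _ => Multiplicative.ofAdd 1) hf
  rw [prodBody_const _ _ (finite_body_join.2 hf)] at h
  simp_rw [prodBody_const _ _ (hf _)] at h
  simpa [← ofAdd_nsmul, ← ofAdd_sum, ← ofAdd_add] using h

theorem ncard_body_pos {T : PlanarTree} (h : T.body.Finite) : 0 < T.body.ncard :=
  (Set.ncard_pos h).2 ⟨[], nil_mem_body T⟩

theorem finite_setOf_ncard_body_le (N : ℕ) :
    {T : PlanarTree | T.body.Finite ∧ T.body.ncard ≤ N}.Finite := by
  induction N with
  | zero =>
    convert Set.finite_empty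
    refine Set.eq_empty_of_forall_notMem fun T hT => ?_
    have := ncard_body_pos hT.1
    have := hT.2
    omega
  | succ N ih =>
    refine ((Set.finite_Iic N).biUnion fun k _ =>
      (Set.Finite.pi' fun _ : Fin k => ih).image (join k)).subset ?_
    rintro T ⟨hT, hN⟩
    obtain ⟨⟨k, f⟩, rfl⟩ := join_bijective.2 T
    simp only at hT hN
    have hf := finite_body_join.1 hT
    rw [ncard_body_join hf] at hN
    have hk : k ≤ ∑ i, (f i).body.ncard := by
      calc k = ∑ i : Fin k, 1 := by simp
        _ ≤ _ := Finset.sum_le_sum fun i _ => ncard_body_pos (hf i)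
    refine Set.mem_biUnion (x := k) (by simp; omega) ⟨f, fun i => ⟨hf i, ?_⟩, rfl⟩
    have := Finset.single_le_sum (f := fun i => (f i).body.ncard) (fun _ _ => Nat.zero_le _)
      (Finset.mem_univ i)
    omega

theorem finite_ofSize (N : ℕ) : (ofSize N).Finite :=
  (finite_setOf_ncard_body_le N).subset fun T hT => by
    have := mem_ofSize.1 hT
    exact ⟨this.1, this.2.le⟩

theorem countable_setOf_finite_body : {T : PlanarTree | T.body.Finite}.Countable := by
  refine (Set.countable_iUnion fun N => (finite_ofSize N).countable).mono fun T hT => ?_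
  exact Set.mem_iUnion.2 ⟨T.body.ncard, mem_ofSize.2 ⟨hT, rfl⟩⟩

end PlanarTree

/-! ### Grafting a tree onto a leaf -/

/-- A finite planar tree with a marked leaf, other than the root. -/
structure MarkedTree where
  /-- the tree -/
  tree : PlanarTree
  /-- the marked leaf, as an element of the body of the tree -/
  mark : List ℕ
  finite : tree.body.Finite
  mark_mem : mark ∈ tree.body
  isLeaf : ∀ i, mark ++ [i] ∉ tree.body

namespace MarkedTree
open PlanarTree

/-- The trees which differ from the given finite tree only in that the marked leaf may have
descendants. -/
def completions (p : MarkedTree) : Set PlanarTree :=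
  {T | p.mark ∈ T.body ∧ ∀ v, ¬ p.mark <+: v → (v ∈ T.body ↔ v ∈ p.tree.body)}

theorem eq_mark {p : MarkedTree} {v : List ℕ} (hv : v ∈ p.tree.body) (h : p.mark <+: v) :
    v = p.mark := by
  obtain ⟨u, rfl⟩ := h
  rcases u with _ | ⟨i, u⟩
  · simp
  · exact absurd (mem_body_of_append (v := u) (by simpa using hv)) (p.isLeaf i)

theorem prefix_append_singleton {p : MarkedTree} {v : List ℕ} {i : ℕ} (h : p.mark <+: v ++ [i])
    (hv : ¬ p.mark <+: v) : v ++ [i] = p.mark := by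
  rcases List.prefix_concat_iff.1 h with h | h
  · exact h.symm
  · exact absurd h hv

/-- The tree obtained by replacing the marked leaf by the tree `S`. -/
def graft (p : MarkedTree) (S : PlanarTree) : PlanarTree :=
  ofBody {v | (v ∈ p.tree.body ∧ ¬ p.mark <+: v) ∨ ∃ u ∈ S.body, v = p.mark ++ u}
    (by
      by_cases h : p.mark = []
      · exact Or.inr ⟨[], nil_mem_body S, by simp [h]⟩
      · exact Or.inl ⟨nil_mem_body _, by simpa using h⟩)
    (by
      rintro v i (⟨h, hn⟩ | ⟨u, hu, h⟩)
      · exact Or.inl ⟨mem_body_of_append_singleton h, fun h' =>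
          hn (h'.trans (List.prefix_append _ _))⟩
      · rcases List.eq_nil_or_concat u with rfl | ⟨u, j, rfl⟩
        · refine Or.inl ⟨mem_body_of_append_singleton (i := i) ?_, fun h' => ?_⟩
          · rw [h, List.append_nil]; exact p.mark_mem
          · have h₁ := h'.length_le
            have h₂ := congrArg List.length h
            simp at h₂
            omega
        · rw [List.concat_eq_append] at hu h
          rw [← List.append_assoc] at h
          obtain ⟨h, -⟩ := List.append_inj' h rfl
          exact Or.inr ⟨u, mem_body_of_append_singleton hu, h⟩)
    (by
      rintro v i j hij (⟨h, hn⟩ | ⟨u, hu, h⟩)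
      · by_cases hm : p.mark <+: v ++ [i]
        · refine Or.inr ⟨[], nil_mem_body S, ?_⟩
          rw [List.append_nil]
          exact prefix_append_singleton hm fun h' => hn (h'.trans (List.prefix_append _ _))
        · exact Or.inl ⟨left_mem_body hij h, hm⟩
      · rcases List.eq_nil_or_concat u with rfl | ⟨u, l, rfl⟩
        · refine Or.inl ⟨left_mem_body hij ?_, fun h' => ?_⟩
          · rw [h, List.append_nil]; exact p.mark_mem
          · have := h'.eq_of_length (by simpa using (congrArg List.length h).symm)
            have h := (List.append_nil _ ▸ h).trans this
            simp at h
            omega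
        · rw [List.concat_eq_append] at hu h
          rw [← List.append_assoc] at h
          obtain ⟨rfl, h⟩ := List.append_inj' h rfl
          obtain rfl : j = l := by simpa using h
          exact Or.inr ⟨u ++ [i], left_mem_body hij hu, by simp⟩)
    (by
      intro v
      have h₁ : {i | v ++ [i] ∈ p.tree.body ∧ ¬ p.mark <+: v ++ [i]}.Finite :=
        (p.tree.finite_children v).subset fun i hi => hi.1
      have h₂ : {i | ∃ u ∈ S.body, v ++ [i] = p.mark ++ u}.Finite := by
        by_cases hm : p.mark <+: v
        · obtain ⟨u, rfl⟩ := hm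
          refine (S.finite_children u).subset ?_
          rintro i ⟨u', hu', h⟩
          rw [List.append_assoc] at h
          rw [Set.mem_ofPred_eq, List.append_cancel_left h]
          exact hu'
        · refine (p.tree.finite_children v).subset ?_
          rintro i ⟨u', hu', h⟩
          have := prefix_append_singleton (i := i) (h ▸ List.prefix_append _ _) hm
          rw [Set.mem_ofPred_eq, this]
          exact p.mark_mem
      exact (h₁.union h₂).subset fun i hi => hi)

theorem body_graft (p : MarkedTree) (S : PlanarTree) :
    (p.graft S).body = (p.tree.body \ {p.mark}) ∪ (fun u => p.mark ++ u) '' S.body := by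
  ext v
  simp only [graft, body_ofBody, Set.mem_union, Set.mem_sdiff, Set.mem_singleton_iff, Set.mem_image]
  refine or_congr (and_congr_right fun hv => ⟨?_, ?_⟩)
    (exists_congr fun u => and_congr Iff.rfl eq_comm)
  · rintro h rfl
    exact h List.prefix_rfl
  · exact fun h h' => h (eq_mark hv h')

theorem append_mem_body_graft {p : MarkedTree} {S : PlanarTree} {v : List ℕ} :
    p.mark ++ v ∈ (p.graft S).body ↔ v ∈ S.body := by
  simp only [graft, body_ofBody, Set.mem_ofPred_eq]
  simp

theorem mem_body_graft_of_not_prefix {p : MarkedTree} {S : PlanarTree} {v : List ℕ}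
    (h : ¬ p.mark <+: v) : v ∈ (p.graft S).body ↔ v ∈ p.tree.body := by
  simp only [graft, body_ofBody, Set.mem_ofPred_eq, h, not_false_eq_true, and_true,
    or_iff_left_iff_imp, forall_exists_index, and_imp]
  rintro u hu rfl
  exact absurd (List.prefix_append _ _) h

/-- Grafting is a bijection from all trees to the completions of a marked tree. -/
theorem bijOn_graft (p : MarkedTree) : Set.BijOn p.graft Set.univ p.completions := by
  refine ⟨fun S _ => ⟨?_, fun v hv => mem_body_graft_of_not_prefix hv⟩, fun S _ S' _ h => ?_,
    fun T hT => ?_⟩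
  · have := (append_mem_body_graft (p := p)).2 (nil_mem_body S)
    rwa [List.append_nil] at this
  · refine body_injective (Set.ext fun v => ?_)
    rw [← append_mem_body_graft (p := p), h, append_mem_body_graft]
  · refine ⟨ofBody {v | p.mark ++ v ∈ T.body} (by simpa using hT.1) ?_ ?_ ?_, Set.mem_univ _, ?_⟩
    · exact fun v i h => mem_body_of_append_singleton (v := p.mark ++ v) (i := i) (by simpa using h)
    · intro v i j hij h
      have := left_mem_body (v := p.mark ++ v) hij (by simpa using h)
      simpa using this
    · intro v
      simpa using T.finite_children (p.mark ++ v)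
    · refine body_injective (Set.ext fun v => ?_)
      by_cases h : p.mark <+: v
      · obtain ⟨v, rfl⟩ := h
        rw [append_mem_body_graft, body_ofBody, Set.mem_ofPred_eq]
      · rw [mem_body_graft_of_not_prefix h, hT.2 v h]

theorem finite_body_graft {p : MarkedTree} {S : PlanarTree} :
    (p.graft S).body.Finite ↔ S.body.Finite := by
  rw [body_graft]
  constructor
  · intro h
    exact Set.Finite.of_finite_image (h.subset Set.subset_union_right)
      (List.append_right_injective _).injOn
  · exact fun h => (p.finite.subset Set.sdiff_subset).union (h.image _)

theorem numChildren_graft {p : MarkedTree} {S : PlanarTree} {v : List ℕ}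
    (hv : v ∈ p.tree.body) (hne : v ≠ p.mark) :
    (p.graft S).numChildren v = p.tree.numChildren v := by
  refine numChildren_congr fun i => ?_
  by_cases h : p.mark <+: v ++ [i]
  · have := prefix_append_singleton h fun h' => hne (eq_mark hv h')
    rw [this]
    refine iff_of_true ?_ p.mark_mem
    have := (append_mem_body_graft (p := p)).2 (nil_mem_body S)
    rwa [List.append_nil] at this
  · exact mem_body_graft_of_not_prefix h

theorem numChildren_mark (p : MarkedTree) : p.tree.numChildren p.mark = 0 :=
  numChildren_eq_of_forall fun i => by simpa using p.isLeaf i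

theorem prodBody_graft {M : Type*} [CommMonoid M] (g : ℕ → M) (p : MarkedTree) {S : PlanarTree}
    (hS : S.body.Finite) :
    g 0 * (p.graft S).prodBody g = p.tree.prodBody g * S.prodBody g := by
  have h₁ : (p.tree.body \ {p.mark}).Finite := p.finite.subset Set.sdiff_subset
  have h₂ : p.tree.prodBody g =
      g 0 * ∏ᶠ v ∈ p.tree.body \ {p.mark}, g (p.tree.numChildren v) := by
    have := finprod_mem_insert (fun v => g (p.tree.numChildren v))
      (a := p.mark) (s := p.tree.body \ {p.mark}) (by simp) h₁
    rw [numChildren_mark, Set.insert_sdiff_singleton, Set.insert_eq_of_mem p.mark_mem] at this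
    exact this
  rw [h₂, mul_assoc, prodBody, body_graft, finprod_mem_union _ h₁ (hS.image _),
    finprod_mem_image (List.append_right_injective _).injOn]
  · congr 2
    · exact finprod_mem_congr rfl fun v hv => by rw [numChildren_graft hv.1 hv.2]
    · refine finprod_mem_congr rfl fun v _ => ?_
      rw [numChildren_congr (T' := S) (v' := v)]
      intro i
      rw [List.append_assoc, append_mem_body_graft]
  · refine Set.disjoint_left.2 ?_
    rintro _ ⟨h, hne⟩ ⟨u, -, rfl⟩
    exact hne (eq_mark h (List.prefix_append _ _))

theorem ncard_body_graft (p : MarkedTree) {S : PlanarTree} (hS : S.body.Finite) :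
    1 + (p.graft S).body.ncard = p.tree.body.ncard + S.body.ncard := by
  have h := prodBody_graft (fun _ => Multiplicative.ofAdd 1) p hS
  rw [prodBody_const _ _ (finite_body_graft.2 hS), prodBody_const _ _ hS,
    prodBody_const _ _ p.finite] at h
  simpa [← ofAdd_nsmul, ← ofAdd_add] using h

end MarkedTree

/-! ### Generating functions -/

theorem ENNReal.tsum_fin_pi {α : Type*} {k : ℕ} (g : Fin k → α → ℝ≥0∞) :
    ∑' f : Fin k → α, ∏ i, g i (f i) = ∏ i, ∑' a, g i a := by
  induction k with
  | zero => simp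
  | succ k ih =>
    rw [← (Fin.consEquiv fun _ => α).tsum_eq, ENNReal.tsum_prod']
    simp only [Fin.consEquiv_apply, Fin.prod_univ_succ, Fin.cons_zero, Fin.cons_succ]
    simp_rw [ENNReal.tsum_mul_left, ih, ENNReal.tsum_mul_right]

theorem ENNReal.tsum_fin_pi_const {α : Type*} (k : ℕ) (g : α → ℝ≥0∞) :
    ∑' f : Fin k → α, ∏ i, g (f i) = (∑' a, g a) ^ k := by
  rw [ENNReal.tsum_fin_pi fun _ => g]
  simp

theorem ENNReal.tsum_fin_pi_mul_sum {α : Type*} (k : ℕ) (g h : α → ℝ≥0∞) :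
    ∑' f : Fin k → α, (∏ i, g (f i)) * ∑ j, h (f j) =
      k * (∑' a, g a) ^ (k - 1) * ∑' a, g a * h a := by
  simp_rw [Finset.mul_sum]
  rw [Summable.tsum_finsetSum fun _ _ => ENNReal.summable]
  have key : ∀ j : Fin k, ∑' f : Fin k → α, (∏ i, g (f i)) * h (f j) =
      (∑' a, g a) ^ (k - 1) * ∑' a, g a * h a := by
    intro j
    have h₁ : ∀ f : Fin k → α, (∏ i, g (f i)) * h (f j) =
        ∏ i, (if i = j then fun a => g a * h a else g) (f i) := by
      intro f
      rw [← Finset.mul_prod_erase _ _ (Finset.mem_univ j),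
        ← Finset.mul_prod_erase (a := j) _ _ (Finset.mem_univ j), if_pos rfl, mul_right_comm]
      congr 1
      exact Finset.prod_congr rfl fun i hi => by rw [if_neg (Finset.ne_of_mem_erase hi)]
    simp_rw [h₁]
    rw [ENNReal.tsum_fin_pi, ← Finset.mul_prod_erase _ _ (Finset.mem_univ j), if_pos rfl, mul_comm]
    congr 1
    rw [Finset.prod_congr rfl (g := fun _ => ∑' a, g a)
      fun i hi => by rw [if_neg (Finset.ne_of_mem_erase hi)]]
    simp
  simp_rw [key]
  simp [mul_assoc]

namespace PlanarTree

open Classical in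
/-- The weight of a finite tree `T` times `ζ ^ |T|`, extended by zero to infinite trees. -/
noncomputable def fugacityWeight (w : ℕ → ℝ) (ζ : ℝ≥0∞) (T : PlanarTree) : ℝ≥0∞ :=
  if T.body.Finite then T.prodBody fun n => ζ * ENNReal.ofReal (w (n + 1)) else 0

/-- The generating function `Z`, with values in `[0, ∞]`. -/
noncomputable def treeSum (w : ℕ → ℝ) (ζ : ℝ≥0∞) : ℝ≥0∞ := ∑' T, fugacityWeight w ζ T

/-- The generating function `φ` of the branching weights, with values in `[0, ∞]`. -/
noncomputable def branchSum (w : ℕ → ℝ) (z : ℝ≥0∞) : ℝ≥0∞ :=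
  ∑' k : ℕ, ENNReal.ofReal (w (k + 1)) * z ^ k

/-- The derivative `φ'` of the generating function of the branching weights. -/
noncomputable def branchDerivSum (w : ℕ → ℝ) (z : ℝ≥0∞) : ℝ≥0∞ :=
  ∑' k : ℕ, ENNReal.ofReal (w (k + 1)) * (k * z ^ (k - 1))

/-- The leaves at distance `K + 1` from the root. -/
def leavesAt (K : ℕ) (T : PlanarTree) : Set (List ℕ) :=
  {v | v.length = K ∧ v ∈ T.body ∧ ∀ i, v ++ [i] ∉ T.body}

/-- The number of leaves at distance `K + 1` from the root. -/
noncomputable def numLeaves (K : ℕ) (T : PlanarTree) : ℝ≥0∞ := ∑' _ : T.leavesAt K, 1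

theorem tsum_eq_tsum_join (F : PlanarTree → ℝ≥0∞) :
    ∑' T, F T = ∑' (k : ℕ) (f : Fin k → PlanarTree), F (join k f) := by
  rw [← (Equiv.ofBijective _ join_bijective).tsum_eq, ENNReal.tsum_sigma']
  rfl

theorem fugacityWeight_join (w : ℕ → ℝ) (ζ : ℝ≥0∞) {k : ℕ} (f : Fin k → PlanarTree) :
    fugacityWeight w ζ (join k f) =
      ζ * ENNReal.ofReal (w (k + 1)) * ∏ i, fugacityWeight w ζ (f i) := by
  by_cases h : ∀ i, (f i).body.Finite
  · rw [fugacityWeight, if_pos (finite_body_join.2 h), prodBody_join _ h]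
    congr 1
    exact Finset.prod_congr rfl fun i _ => by rw [fugacityWeight, if_pos (h i)]
  · rw [fugacityWeight, if_neg (by rwa [finite_body_join])]
    obtain ⟨i, hi⟩ := not_forall.1 h
    rw [Finset.prod_eq_zero (Finset.mem_univ i), mul_zero]
    rw [fugacityWeight, if_neg hi]

theorem treeSum_eq (w : ℕ → ℝ) (ζ : ℝ≥0∞) : treeSum w ζ = ζ * branchSum w (treeSum w ζ) := by
  conv_lhs => rw [treeSum, tsum_eq_tsum_join]
  simp_rw [fugacityWeight_join, ENNReal.tsum_mul_left, ENNReal.tsum_fin_pi_const]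
  rw [branchSum, ← ENNReal.tsum_mul_left]
  exact tsum_congr fun k => mul_assoc _ _ _

theorem numLeaves_succ_join (K : ℕ) {k : ℕ} (f : Fin k → PlanarTree) :
    numLeaves (K + 1) (join k f) = ∑ i, numLeaves K (f i) := by
  let F : ((i : Fin k) × (f i).leavesAt K) → (join k f).leavesAt (K + 1) := fun x =>
    ⟨x.1.1 :: x.2.1, by simp [x.2.2.1], coe_cons_mem_body_join.2 x.2.2.2.1, fun i h =>
      x.2.2.2.2 i (coe_cons_mem_body_join.1 h)⟩
  have hF : Function.Bijective F := by
    constructor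
    · rintro ⟨i, v, hv⟩ ⟨j, u, hu⟩ h
      have h' : i.1 :: v = j.1 :: u := congrArg Subtype.val h
      obtain ⟨h₁, rfl⟩ := List.cons.inj h'
      obtain rfl : i = j := Fin.ext h₁
      rfl
    · rintro ⟨v, hv, hm, hl⟩
      rcases v with _ | ⟨a, v⟩
      · simp at hv
      · obtain ⟨ha, hm⟩ := cons_mem_body_join.1 hm
        refine ⟨⟨⟨a, ha⟩, ⟨v, by simpa using hv, hm, fun i h => hl i ?_⟩⟩, rfl⟩
        exact cons_mem_body_join.2 ⟨ha, h⟩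
  rw [numLeaves, ← (Equiv.ofBijective F hF).tsum_eq, ENNReal.tsum_sigma', tsum_fintype]
  rfl

theorem numLeaves_zero_join_succ {k : ℕ} (f : Fin (k + 1) → PlanarTree) :
    numLeaves 0 (join (k + 1) f) = 0 := by
  have : IsEmpty ((join (k + 1) f).leavesAt 0) := by
    refine ⟨?_⟩
    rintro ⟨v, hv, -, hl⟩
    obtain rfl := List.length_eq_zero_iff.1 hv
    exact hl 0 (cons_mem_body_join.2 ⟨by omega, nil_mem_body _⟩)
  rw [numLeaves, tsum_empty]

theorem numLeaves_zero_join_zero (f : Fin 0 → PlanarTree) : numLeaves 0 (join 0 f) = 1 := by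
  have : (join 0 f).leavesAt 0 = {[]} := by
    ext v
    constructor
    · rintro ⟨hv, -⟩
      exact List.length_eq_zero_iff.1 hv
    · rintro rfl
      exact ⟨rfl, nil_mem_body _, fun i h => by
        obtain ⟨h, -⟩ := cons_mem_body_join.1 h
        omega⟩
  rw [numLeaves, this, tsum_singleton (f := fun _ => (1 : ℝ≥0∞))]

/-- The path to a marked leaf at distance `K + 1` from the root passes through `K` vertices in
between; each contributes an edge, a weight, and, for all but one of its children, a free branch,
hence a factor `ζ φ'(Z(ζ))`. -/
theorem tsum_fugacityWeight_mul_numLeaves (w : ℕ → ℝ) (ζ : ℝ≥0∞) (K : ℕ) :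
    ∑' T, fugacityWeight w ζ T * numLeaves K T =
      (ζ * branchDerivSum w (treeSum w ζ)) ^ K * (ζ * ENNReal.ofReal (w 1)) := by
  induction K with
  | zero =>
    rw [tsum_eq_tsum_join, tsum_eq_single 0]
    · simp [fugacityWeight_join, numLeaves_zero_join_zero]
    · intro k hk
      obtain ⟨k, rfl⟩ := Nat.exists_eq_succ_of_ne_zero hk
      simp [numLeaves_zero_join_succ]
  | succ K ih =>
    rw [tsum_eq_tsum_join]
    simp_rw [fugacityWeight_join, numLeaves_succ_join, mul_assoc (ζ * _), ENNReal.tsum_mul_left,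
      ENNReal.tsum_fin_pi_mul_sum, ih]
    rw [pow_succ', branchDerivSum, ← ENNReal.tsum_mul_left, mul_assoc, ← ENNReal.tsum_mul_right]
    refine tsum_congr fun k => ?_
    rw [treeSum]
    ring

theorem fugacityWeight_eq {w : ℕ → ℝ} (hw : ∀ n, 1 ≤ n → 0 ≤ w n) {T : PlanarTree}
    (hT : T.body.Finite) (ζ : ℝ≥0∞) :
    fugacityWeight w ζ T = ENNReal.ofReal (T.weight w) * ζ ^ T.body.ncard := by
  rw [fugacityWeight, if_pos hT, weight_eq_prodBody, ← prodBody_const _ _ hT, prodBody, prodBody,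
    prodBody, finprod_mem_mul_distrib hT, mul_comm]
  simp_rw [finprod_mem_eq_finite_toFinset_prod _ hT]
  rw [ENNReal.ofReal_prod_of_nonneg]
  exact fun v _ => hw _ (by omega)

theorem weight_nonneg {w : ℕ → ℝ} (hw : ∀ n, 1 ≤ n → 0 ≤ w n) (T : PlanarTree) :
    0 ≤ T.weight w := by
  rw [weight_eq]
  exact finprod_nonneg fun v => finprod_nonneg fun _ => hw _ (by omega)

theorem partitionFunction_eq (w : ℕ → ℝ) (N : ℕ) :
    partitionFunction w N = ∑ T ∈ (finite_ofSize N).toFinset, T.weight w :=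
  finsum_mem_eq_finite_toFinset_sum _ _

theorem partitionFunction_nonneg {w : ℕ → ℝ} (hw : ∀ n, 1 ≤ n → 0 ≤ w n) (N : ℕ) :
    0 ≤ partitionFunction w N := by
  rw [partitionFunction_eq]
  exact Finset.sum_nonneg fun T _ => weight_nonneg hw T

theorem treeSum_eq_tsum {w : ℕ → ℝ} (hw : ∀ n, 1 ≤ n → 0 ≤ w n) (ζ : ℝ≥0∞) :
    treeSum w ζ = ∑' N : ℕ, ENNReal.ofReal (partitionFunction w N) * ζ ^ N := by
  classical
  have h : ∀ T, fugacityWeight w ζ T =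
      ∑' N : ℕ, if T ∈ ofSize N then ENNReal.ofReal (T.weight w) * ζ ^ N else 0 := by
    intro T
    by_cases hT : T.body.Finite
    · rw [tsum_eq_single T.body.ncard, if_pos (mem_ofSize.2 ⟨hT, rfl⟩), fugacityWeight_eq hw hT]
      exact fun N hN => if_neg fun h => hN (mem_ofSize.1 h).2.symm
    · rw [fugacityWeight, if_neg hT, ENNReal.tsum_eq_zero.2]
      exact fun N => if_neg fun h => hT (mem_ofSize.1 h).1
  rw [treeSum, tsum_congr h, ENNReal.tsum_comm]
  refine tsum_congr fun N => ?_
  rw [tsum_eq_sum (s := (finite_ofSize N).toFinset), partitionFunction_eq,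
    ENNReal.ofReal_sum_of_nonneg fun T _ => weight_nonneg hw T, Finset.sum_mul]
  · exact Finset.sum_congr rfl fun T hT => if_pos (by simpa using hT)
  · exact fun T hT => if_neg (by simpa using hT)

/-- `Z(ζ)` is the smallest solution of `ζ φ(z) = z`, and even of `ζ φ(z) ≤ z`: by induction, `z`
bounds the contribution of the trees of bounded height. -/
theorem treeSum_le_of_mul_branchSum_le {w : ℕ → ℝ} {ζ z : ℝ≥0∞} (h : ζ * branchSum w z ≤ z) :
    treeSum w ζ ≤ z := by
  classical
  let F : ℕ → PlanarTree → ℝ≥0∞ := fun n T =>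
    if ∀ v ∈ T.body, v.length < n then fugacityWeight w ζ T else 0
  have hF : ∀ n, ∑' T, F n T ≤ z := by
    intro n
    induction n with
    | zero =>
      rw [ENNReal.tsum_eq_zero.2 fun T => if_neg fun h => by simpa using h [] (nil_mem_body T)]
      exact zero_le
    | succ n ih =>
      have hjoin : ∀ (k : ℕ) (f : Fin k → PlanarTree), F (n + 1) (join k f) ≤
          ζ * ENNReal.ofReal (w (k + 1)) * ∏ i, F n (f i) := by
        intro k f
        by_cases hl : ∀ v ∈ (join k f).body, v.length < n + 1
        · simp only [F]
          rw [if_pos hl, fugacityWeight_join]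
          gcongr with i
          rw [if_pos]
          intro v hv
          simpa using hl _ (coe_cons_mem_body_join.2 hv)
        · simp only [F]
          rw [if_neg hl]
          exact zero_le
      rw [tsum_eq_tsum_join]
      calc ∑' (k : ℕ) (f : Fin k → PlanarTree), F (n + 1) (join k f)
          ≤ ∑' (k : ℕ) (f : Fin k → PlanarTree),
              ζ * ENNReal.ofReal (w (k + 1)) * ∏ i, F n (f i) :=
            ENNReal.tsum_le_tsum fun k => ENNReal.tsum_le_tsum fun f => hjoin k f
        _ = ζ * ∑' k : ℕ, ENNReal.ofReal (w (k + 1)) * (∑' T, F n T) ^ k := by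
            simp_rw [ENNReal.tsum_mul_left, ENNReal.tsum_fin_pi_const, ← ENNReal.tsum_mul_left,
              mul_assoc]
        _ ≤ ζ * branchSum w z := by
            rw [branchSum]
            gcongr
        _ ≤ z := h
  refine ENNReal.summable.tsum_le_of_sum_le fun s => ?_
  have hs : ∃ n, ∀ T ∈ s, T.body.Finite → ∀ v ∈ T.body, v.length < n := by
    have hfin : {v : List ℕ | ∃ T ∈ s, T.body.Finite ∧ v ∈ T.body}.Finite := by
      have h₁ : (↑s ∩ {T : PlanarTree | T.body.Finite} : Set PlanarTree).Finite :=
        s.finite_toSet.subset Set.inter_subset_left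
      have h₂ : (⋃ T ∈ (↑s ∩ {T : PlanarTree | T.body.Finite} : Set PlanarTree), T.body).Finite :=
        h₁.biUnion fun T hT => hT.2
      refine h₂.subset ?_
      rintro v ⟨T, hT, hf, hv⟩
      exact Set.mem_biUnion (x := T) ⟨hT, hf⟩ hv
    obtain ⟨n, hn⟩ := (hfin.image List.length).bddAbove
    exact ⟨n + 1, fun T hT hf v hv => Nat.lt_succ_of_le (hn ⟨v, ⟨T, hT, hf, hv⟩, rfl⟩)⟩
  obtain ⟨n, hn⟩ := hs
  calc ∑ T ∈ s, fugacityWeight w ζ T ≤ ∑ T ∈ s, F n T := by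
        refine Finset.sum_le_sum fun T hT => ?_
        by_cases hf : T.body.Finite
        · simp only [F]
          rw [if_pos (hn T hT hf)]
        · rw [fugacityWeight, if_neg hf]
          exact zero_le
    _ ≤ ∑' T, F n T := ENNReal.sum_le_tsum s
    _ ≤ z := hF n

end PlanarTree

/-! ### Radii of convergence -/

namespace PlanarTree

theorem tsum_ofReal_mul_pow_ne_top {a : ℕ → ℝ} (ha : ∀ n, 0 ≤ a n) {x : ℝ≥0∞}
    (hx : x < convergenceRadius a) : ∑' n, ENNReal.ofReal (a n) * x ^ n ≠ ∞ := by
  lift x to NNReal using hx.ne_top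
  have h := (FormalMultilinearSeries.ofScalars (𝕜 := ℝ) ℝ a).summable_norm_mul_pow hx
  simp_rw [FormalMultilinearSeries.ofScalars_norm, Real.norm_of_nonneg (ha _)] at h
  convert h.tsum_ofReal_ne_top using 3 with n
  rw [ENNReal.ofReal_mul (ha n), ← NNReal.coe_pow, ENNReal.ofReal_coe_nnreal, ENNReal.coe_pow]

theorem le_convergenceRadius {a : ℕ → ℝ} (ha : ∀ n, 0 ≤ a n) {x : ℝ≥0∞} (hx : x ≠ ∞)
    (h : ∑' n, ENNReal.ofReal (a n) * x ^ n ≠ ∞) : x ≤ convergenceRadius a := by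
  lift x to NNReal using hx
  refine FormalMultilinearSeries.le_radius_of_summable_norm _ ?_
  simp_rw [FormalMultilinearSeries.ofScalars_norm, Real.norm_of_nonneg (ha _)]
  convert ENNReal.summable_toReal h using 2 with n
  simp [ENNReal.toReal_ofReal (ha n)]

/-- The second derivative `φ''` of the generating function of the branching weights. -/
noncomputable def branchSecondDerivSum (w : ℕ → ℝ) (z : ℝ≥0∞) : ℝ≥0∞ :=
  ∑' k : ℕ, ENNReal.ofReal (w (k + 1)) * (k * ((k - 1 : ℕ) * z ^ (k - 2)))

theorem branchSecondDerivSum_ne_top {w : ℕ → ℝ} (hw : ∀ n, 1 ≤ n → 0 ≤ w n) {z : ℝ≥0∞}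
    (hz : z < zCrit w) : branchSecondDerivSum w z ≠ ∞ := by
  obtain ⟨y, hzy, hy⟩ := exists_between hz
  obtain ⟨t, hyt, ht⟩ := exists_between hy
  lift t to NNReal using ht.ne_top
  lift y to NNReal using hy.ne_top
  have hy0 : 0 < y := by
    have := zero_le.trans_lt hzy
    exact_mod_cast this
  have hyt : y < t := by exact_mod_cast hyt
  have ht0 : 0 < t := hy0.trans hyt
  obtain ⟨C, hC, hbound⟩ := FormalMultilinearSeries.norm_mul_pow_le_of_lt_radius _ ht
  simp_rw [FormalMultilinearSeries.ofScalars_norm] at hbound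
  have hr : ‖(y / t : ℝ)‖ < 1 := by
    rw [Real.norm_of_nonneg (by positivity), div_lt_one (by positivity)]
    exact_mod_cast hyt
  have hs := ((summable_pow_mul_geometric_of_norm_lt_one 2 hr).mul_left (C / y ^ 2))
  refine ne_top_of_le_ne_top hs.tsum_ofReal_ne_top (ENNReal.tsum_le_tsum fun k => ?_)
  rcases Nat.lt_or_ge k 2 with hk | hk
  · have : k = 0 ∨ k = 1 := by omega
    rcases this with rfl | rfl <;> simp
  · calc ENNReal.ofReal (w (k + 1)) * (k * ((k - 1 : ℕ) * z ^ (k - 2)))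
        ≤ ENNReal.ofReal (w (k + 1)) * (k * (k * (y : ℝ≥0∞) ^ (k - 2))) := by
          gcongr
          omega
      _ = ENNReal.ofReal (w (k + 1) * (k * (k * (y : ℝ) ^ (k - 2)))) := by
          rw [ENNReal.ofReal_mul (hw _ (by omega)), ENNReal.ofReal_mul (by positivity),
            ENNReal.ofReal_mul (by positivity), ENNReal.ofReal_pow (by positivity)]
          simp
      _ ≤ _ := by
          refine ENNReal.ofReal_le_ofReal ?_
          have h := hbound k
          rw [Real.norm_of_nonneg (hw _ (by omega))] at h
          have hy2 : (y : ℝ) ^ k = y ^ (k - 2) * y ^ 2 := by rw [← pow_add]; congr 1; omega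
          have e : C / (y : ℝ) ^ 2 * ((k : ℝ) ^ 2 * (y / t : ℝ) ^ k) =
              C / (t : ℝ) ^ k * (k * (k * (y : ℝ) ^ (k - 2))) := by
            rw [div_pow, hy2]
            field_simp
          rw [e]
          gcongr
          rw [le_div_iff₀ (by positivity)]
          exact h

/-! ### Convexity of the generating function of the branching weights -/

theorem add_pow_le_pow_add (z d : ℝ≥0∞) (n : ℕ) :
    (z + d) ^ n ≤ z ^ n + d * (n * (z + d) ^ (n - 1)) := by
  induction n with
  | zero => simp
  | succ n ih =>
    have h₁ : z * (n * (z + d) ^ (n - 1)) ≤ n * (z + d) ^ n := by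
      rcases n with _ | n
      · simp
      · rw [Nat.add_sub_cancel, pow_succ', mul_left_comm]
        gcongr
        exact le_self_add
    calc (z + d) ^ (n + 1) = z * (z + d) ^ n + d * (z + d) ^ n := by ring
      _ ≤ z * (z ^ n + d * (n * (z + d) ^ (n - 1))) + d * (z + d) ^ n := by gcongr
      _ = z ^ (n + 1) + d * (z * (n * (z + d) ^ (n - 1)) + (z + d) ^ n) := by ring
      _ ≤ z ^ (n + 1) + d * (n * (z + d) ^ n + (z + d) ^ n) := by gcongr
      _ = _ := by rw [Nat.add_sub_cancel]; push_cast; ring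

theorem add_pow_add_sq_le (z d : ℝ≥0∞) (n : ℕ) :
    (z + d) ^ (n + 2) + d ^ 2 * (z + d) ^ n ≤
      z ^ (n + 2) + d * ((n + 2 : ℕ) * (z + d) ^ (n + 1)) := by
  induction n with
  | zero => refine le_of_eq ?_; push_cast; ring
  | succ n ih =>
    calc (z + d) ^ (n + 1 + 2) + d ^ 2 * (z + d) ^ (n + 1)
        = (z + d) * ((z + d) ^ (n + 2) + d ^ 2 * (z + d) ^ n) := by ring
      _ ≤ (z + d) * (z ^ (n + 2) + d * ((n + 2 : ℕ) * (z + d) ^ (n + 1))) := by gcongr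
      _ = z ^ (n + 1 + 2) + d * (z ^ (n + 2) + (n + 2 : ℕ) * (z + d) ^ (n + 2)) := by ring
      _ ≤ z ^ (n + 1 + 2) + d * ((z + d) ^ (n + 2) + (n + 2 : ℕ) * (z + d) ^ (n + 2)) := by
        gcongr
        exact le_self_add
      _ = _ := by push_cast; ring

theorem branchSum_add_le (w : ℕ → ℝ) (z d : ℝ≥0∞) :
    branchSum w (z + d) ≤ branchSum w z + d * branchDerivSum w (z + d) := by
  rw [branchSum, branchSum, branchDerivSum, ← ENNReal.tsum_mul_left, ← ENNReal.tsum_add]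
  refine ENNReal.tsum_le_tsum fun k => ?_
  rw [mul_left_comm, ← mul_add]
  gcongr
  exact add_pow_le_pow_add z d k

theorem branchDerivSum_add_le (w : ℕ → ℝ) {z d R : ℝ≥0∞} (hR : z + d ≤ R) :
    branchDerivSum w (z + d) ≤ branchDerivSum w z + d * branchSecondDerivSum w R := by
  rw [branchDerivSum, branchDerivSum, branchSecondDerivSum, ← ENNReal.tsum_mul_left,
    ← ENNReal.tsum_add]
  refine ENNReal.tsum_le_tsum fun k => ?_
  rw [mul_left_comm d, mul_left_comm d, ← mul_add, ← mul_add]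
  gcongr
  refine (add_pow_le_pow_add z d (k - 1)).trans ?_
  rw [show k - 1 - 1 = k - 2 by omega]
  gcongr

theorem branchSum_add_sq_le (w : ℕ → ℝ) (z d : ℝ≥0∞) (n : ℕ) :
    branchSum w (z + d) + ENNReal.ofReal (w (n + 3)) * (d ^ 2 * (z + d) ^ n) ≤
      branchSum w z + d * branchDerivSum w (z + d) := by
  classical
  have h : ENNReal.ofReal (w (n + 3)) * (d ^ 2 * (z + d) ^ n) =
      ∑' k : ℕ, ENNReal.ofReal (w (k + 1)) * if k = n + 2 then d ^ 2 * (z + d) ^ n else 0 := by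
    rw [tsum_eq_single (n + 2) fun k hk => by simp [hk], if_pos rfl]
  rw [h, branchSum, branchSum, branchDerivSum, ← ENNReal.tsum_mul_left, ← ENNReal.tsum_add,
    ← ENNReal.tsum_add]
  refine ENNReal.tsum_le_tsum fun k => ?_
  rw [mul_left_comm, ← mul_add, ← mul_add]
  refine mul_le_mul' le_rfl ?_
  split_ifs with hk
  · subst hk
    exact add_pow_add_sq_le z d n
  · simpa using add_pow_le_pow_add z d k

theorem le_branchSum (w : ℕ → ℝ) (z : ℝ≥0∞) (k : ℕ) :
    ENNReal.ofReal (w (k + 1)) * z ^ k ≤ branchSum w z :=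
  ENNReal.le_tsum (f := fun k : ℕ => ENNReal.ofReal (w (k + 1)) * z ^ k) k

/-! ### Criticality -/

theorem le_zetaCrit {w : ℕ → ℝ} (hw : ∀ n, 1 ≤ n → 0 ≤ w n) {ζ : ℝ≥0∞} (hζ : ζ ≠ ∞)
    (h : treeSum w ζ ≠ ∞) : ζ ≤ zetaCrit w :=
  le_convergenceRadius (partitionFunction_nonneg hw) hζ (by rwa [← treeSum_eq_tsum hw])

theorem treeSum_ne_top_of_lt {w : ℕ → ℝ} (hw : ∀ n, 1 ≤ n → 0 ≤ w n) {ζ : ℝ≥0∞}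
    (h : ζ < zetaCrit w) : treeSum w ζ ≠ ∞ := by
  rw [treeSum_eq_tsum hw]
  exact tsum_ofReal_mul_pow_ne_top (partitionFunction_nonneg hw) h

theorem treeSum_mono (w : ℕ → ℝ) : Monotone (treeSum w) := by
  intro ζ ζ' h
  refine treeSum_le_of_mul_branchSum_le ?_
  conv_rhs => rw [treeSum_eq]
  gcongr

theorem branchSum_ne_zero {w : ℕ → ℝ} (hw : 0 < w 1) (z : ℝ≥0∞) : branchSum w z ≠ 0 := by
  have := le_branchSum w z 0
  rw [pow_zero, mul_one, zero_add] at this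
  exact ((ENNReal.ofReal_pos.2 hw).trans_le this).ne'

theorem zetaCrit_pos {w : ℕ → ℝ} (hw : IsGeneric w) : 0 < zetaCrit w := by
  obtain ⟨z, hz0, hz⟩ := exists_between hw.zCrit_pos
  have hφ : branchSum w z ≠ ∞ := tsum_ofReal_mul_pow_ne_top (fun n => hw.nonneg _ (by omega)) hz
  have hφ0 := branchSum_ne_zero hw.one_pos z
  refine (ENNReal.div_pos hz0.ne' hφ).trans_le
    (le_zetaCrit hw.nonneg (ENNReal.div_ne_top hz.ne_top hφ0) ?_)
  exact ne_top_of_le_ne_top hz.ne_top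
    (treeSum_le_of_mul_branchSum_le (ENNReal.div_mul_cancel hφ0 hφ).le)

/-- If `Z(ζ)` is finite then `Z ≥ ζ w_n Z ^ (n - 1)` and `Z ≥ ζ w_1` bound `ζ`. -/
theorem zetaCrit_ne_top {w : ℕ → ℝ} (hw : IsGeneric w) : zetaCrit w ≠ ∞ := by
  intro htop
  obtain ⟨n, hn, hwn⟩ := hw.branching
  obtain ⟨n, rfl⟩ := Nat.exists_eq_add_of_le' hn
  set κ := ENNReal.ofReal (w (n + 3)) * ENNReal.ofReal (w 1) ^ (n + 1) with hκ
  have h1 := ENNReal.ofReal_pos.2 hw.one_pos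
  have hκ0 : κ ≠ 0 := mul_ne_zero (ENNReal.ofReal_pos.2 hwn).ne' (pow_ne_zero _ h1.ne')
  obtain ⟨N, hN⟩ := ENNReal.exists_nat_mul_gt hκ0 ENNReal.one_ne_top
  have hN1 : (1 : ℝ≥0∞) ≤ N := by
    rcases N with _ | N
    · simp at hN
    · exact_mod_cast Nat.succ_pos N
  have hZ : treeSum w N ≠ ∞ := treeSum_ne_top_of_lt hw.nonneg (by simp [htop])
  have hle : ∀ k, N * (ENNReal.ofReal (w (k + 1)) * treeSum w N ^ k) ≤ treeSum w N := by
    intro k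
    conv_rhs => rw [treeSum_eq]
    gcongr
    exact le_branchSum w _ k
  have h0 := hle 0
  rw [zero_add, pow_zero, mul_one] at h0
  have h0' : ENNReal.ofReal (w 1) ≤ treeSum w N := (le_mul_of_one_le_left zero_le hN1).trans h0
  have hpos : treeSum w N ≠ 0 := (h1.trans_le h0').ne'
  refine absurd (hN.trans_le ?_) (lt_irrefl 1)
  rw [← ENNReal.mul_le_mul_iff_left hpos hZ, one_mul]
  calc N * κ * treeSum w N
      ≤ N * (ENNReal.ofReal (w (n + 3)) * treeSum w N ^ (n + 1)) * treeSum w N := by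
        rw [hκ]; gcongr
    _ = N * (ENNReal.ofReal (w (n + 2 + 1)) * treeSum w N ^ (n + 2)) := by ring
    _ ≤ _ := hle _

theorem ofReal_toReal_zetaCrit {w : ℕ → ℝ} (hw : IsGeneric w) :
    ENNReal.ofReal (zetaCrit w).toReal = zetaCrit w := ENNReal.ofReal_toReal (zetaCrit_ne_top hw)

theorem treeSum_zetaCrit_lt {w : ℕ → ℝ} (hw : IsGeneric w) :
    treeSum w (zetaCrit w) < zCrit w := by
  obtain ⟨Z₀, hlim, hZ₀⟩ := hw.generic
  refine lt_of_le_of_lt ?_ hZ₀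
  have hnn := partitionFunction_nonneg hw.nonneg
  set ζ₀ := (zetaCrit w).toReal with hζ₀
  have hpos : 0 < ζ₀ := ENNReal.toReal_pos (zetaCrit_pos hw).ne' (zetaCrit_ne_top hw)
  rw [treeSum_eq_tsum hw.nonneg]
  refine ENNReal.tsum_le_of_sum_range_le fun n => ?_
  have hsum : ∀ ζ : ℝ, 0 ≤ ζ → ∑ N ∈ Finset.range n, ENNReal.ofReal (partitionFunction w N) *
      ENNReal.ofReal ζ ^ N =
        ENNReal.ofReal (∑ N ∈ Finset.range n, partitionFunction w N * ζ ^ N) := by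
    intro ζ hζ
    rw [ENNReal.ofReal_sum_of_nonneg fun N _ => mul_nonneg (hnn N) (pow_nonneg hζ N)]
    exact Finset.sum_congr rfl fun N _ => by
      rw [ENNReal.ofReal_mul (hnn N), ENNReal.ofReal_pow hζ]
  rw [← ofReal_toReal_zetaCrit hw, hsum _ hpos.le]
  refine ENNReal.ofReal_le_ofReal ?_
  have hc : Continuous fun ζ : ℝ => ∑ N ∈ Finset.range n, partitionFunction w N * ζ ^ N := by
    fun_prop
  refine le_of_tendsto_of_tendsto ((hc.tendsto ζ₀).mono_left nhdsWithin_le_nhds) hlim ?_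
  filter_upwards [Ioo_mem_nhdsLT hpos] with ζ hζ
  have hfin := treeSum_ne_top_of_lt hw.nonneg (ζ := ENNReal.ofReal ζ)
    (by rw [← ofReal_toReal_zetaCrit hw]; exact (ENNReal.ofReal_lt_ofReal_iff hpos).2 hζ.2)
  rw [treeSum_eq_tsum hw.nonneg] at hfin
  have hs : Summable fun N => partitionFunction w N * ζ ^ N := by
    convert ENNReal.summable_toReal hfin using 2 with N
    simp [ENNReal.toReal_ofReal (hnn N), ENNReal.toReal_ofReal hζ.1.le]
  exact hs.sum_le_tsum _ fun N _ => mul_nonneg (hnn N) (pow_nonneg hζ.1.le N)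

theorem treeSum_zetaCrit_ne_top {w : ℕ → ℝ} (hw : IsGeneric w) : treeSum w (zetaCrit w) ≠ ∞ :=
  (treeSum_zetaCrit_lt hw).ne_top

/-- If `ζ₀ φ'(Z(ζ₀))` were less than `1`, then `ζ φ(z) ≤ z` would have a solution with `ζ > ζ₀`
close to `ζ₀`, and `Z(ζ)` would be finite. -/
theorem one_le_zetaCrit_mul_branchDerivSum {w : ℕ → ℝ} (hw : IsGeneric w) :
    1 ≤ zetaCrit w * branchDerivSum w (treeSum w (zetaCrit w)) := by
  by_contra! hlt
  set ζ := zetaCrit w with hζ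
  set z := treeSum w ζ with hz
  have hζ0 : ζ ≠ 0 := (zetaCrit_pos hw).ne'
  have hζt : ζ ≠ ∞ := zetaCrit_ne_top hw
  have hzt : z ≠ ∞ := treeSum_zetaCrit_ne_top hw
  obtain ⟨R, hzR, hR⟩ := exists_between (treeSum_zetaCrit_lt hw)
  have hM : branchSecondDerivSum w R ≠ ∞ := branchSecondDerivSum_ne_top hw.nonneg hR
  set M := branchSecondDerivSum w R with hMdef
  have hev : ∀ᶠ d in 𝓝[>] (0 : ℝ≥0∞), 0 < d ∧ z + d < R ∧
      ζ * (branchDerivSum w z + d * M) < 1 := by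
    have h₁ : Tendsto (fun d : ℝ≥0∞ => z + d) (𝓝[>] 0) (𝓝 (z + 0)) :=
      (tendsto_const_nhds.add tendsto_id).mono_left nhdsWithin_le_nhds
    have h₂ : Tendsto (fun d : ℝ≥0∞ => ζ * (branchDerivSum w z + d * M)) (𝓝[>] 0)
        (𝓝 (ζ * (branchDerivSum w z + 0 * M))) := by
      refine Tendsto.mono_left ?_ nhdsWithin_le_nhds
      refine ENNReal.Tendsto.const_mul (tendsto_const_nhds.add ?_) (Or.inr hζt)
      exact ENNReal.Tendsto.mul_const tendsto_id (Or.inr hM)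
    rw [add_zero] at h₁
    rw [zero_mul, add_zero] at h₂
    filter_upwards [self_mem_nhdsWithin, h₁.eventually_lt_const hzR, h₂.eventually_lt_const hlt]
      with d h₁ h₂ h₃ using ⟨h₁, h₂, h₃⟩
  obtain ⟨d, hd0, hdR, hd⟩ := hev.exists
  have hdt : d ≠ ∞ := fun h => by simp [h] at hdR
  have hlt' : ζ * branchSum w (z + d) < z + d := by
    calc ζ * branchSum w (z + d)
        ≤ ζ * (branchSum w z + d * (branchDerivSum w z + d * M)) := by
          gcongr
          refine (branchSum_add_le w z d).trans ?_
          gcongr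
          exact branchDerivSum_add_le w hdR.le
      _ = z + d * (ζ * (branchDerivSum w z + d * M)) := by
          rw [mul_add, hz, ← treeSum_eq]; ring
      _ < z + d := by
          refine ENNReal.add_lt_add_left hzt ?_
          calc d * (ζ * (branchDerivSum w z + d * M)) < d * 1 :=
                ENNReal.mul_lt_mul_right hd0.ne' hdt hd
            _ = d := mul_one d
  have hφ0 := branchSum_ne_zero hw.one_pos (z + d)
  have hφt : branchSum w (z + d) ≠ ∞ := fun h => by
    rw [h, ENNReal.mul_top hζ0] at hlt'
    exact not_top_lt hlt'
  have hlt'' : ζ < (z + d) / branchSum w (z + d) :=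
    (ENNReal.lt_div_iff_mul_lt (Or.inl hφ0) (Or.inl hφt)).2 hlt'
  refine hlt''.not_ge (le_zetaCrit hw.nonneg (ENNReal.div_ne_top (by finiteness) hφ0) ?_)
  refine ne_top_of_le_ne_top (b := z + d) (by finiteness) (treeSum_le_of_mul_branchSum_le ?_)
  exact (ENNReal.div_mul_cancel hφ0 hφt).le

/-- `φ` being strictly convex, `Z` has at most a square root singularity at the critical fugacity,
and so has `φ'(Z)`. -/
theorem exists_one_le_mul_branchDerivSum_add {w : ℕ → ℝ} (hw : IsGeneric w)
    (hcrit : zetaCrit w * branchDerivSum w (treeSum w (zetaCrit w)) = 1) :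
    ∃ C : ℝ, 0 ≤ C ∧ ∀ x : ℝ, 1 / 2 ≤ x → x < 1 →
      1 ≤ ENNReal.ofReal x * zetaCrit w *
        branchDerivSum w (treeSum w (ENNReal.ofReal x * zetaCrit w)) +
          ENNReal.ofReal (C * √(1 - x)) := by
  set ζ := zetaCrit w with hζ
  set z₀ := treeSum w ζ with hz₀
  have hζ0 : ζ ≠ 0 := (zetaCrit_pos hw).ne'
  have hζt : ζ ≠ ∞ := zetaCrit_ne_top hw
  have hzt : z₀ ≠ ∞ := treeSum_zetaCrit_ne_top hw
  have hz0 : z₀ ≠ 0 := by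
    rw [hz₀, treeSum_eq]
    exact mul_ne_zero hζ0 (branchSum_ne_zero hw.one_pos _)
  have hMt : branchSecondDerivSum w z₀ ≠ ∞ :=
    branchSecondDerivSum_ne_top hw.nonneg (treeSum_zetaCrit_lt hw)
  set M := branchSecondDerivSum w z₀
  obtain ⟨n, hn, hwn⟩ := hw.branching
  obtain ⟨n, rfl⟩ := Nat.exists_eq_add_of_le' hn
  set κ := ζ * (ENNReal.ofReal (w (n + 3)) * z₀ ^ n) with hκ
  have hκ0 : κ ≠ 0 :=
    mul_ne_zero hζ0 (mul_ne_zero (ENNReal.ofReal_pos.2 hwn).ne' (pow_ne_zero _ hz0))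
  have hκt : κ ≠ ∞ := by finiteness
  have hκr : 0 < κ.toReal := ENNReal.toReal_pos hκ0 hκt
  set b := 2 * z₀.toReal / κ.toReal with hb
  have hb0 : 0 ≤ b := by positivity
  refine ⟨(ζ * M).toReal * √b + 1, by positivity, fun x hx hx1 => ?_⟩
  have hx0 : 0 < x := by linarith
  set X := ENNReal.ofReal x with hX
  have hXt : X ≠ ∞ := ENNReal.ofReal_ne_top
  have hX1 : X ≤ 1 := ENNReal.ofReal_le_one.2 hx1.le
  set z := treeSum w (X * ζ) with hz
  have hzz : z ≤ z₀ := treeSum_mono w (mul_le_of_le_one_left zero_le hX1)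
  obtain ⟨d, hd⟩ := exists_add_of_le hzz
  have hzt' : z ≠ ∞ := ne_top_of_le_ne_top hzt hzz
  have hdt : d ≠ ∞ := fun h => hzt (by rw [hd, h, add_top])
  -- Strict convexity of `φ` between `z` and `z₀ = z + d`, multiplied by `x ζ₀`; the linear terms
  -- in `d` cancel by criticality.
  have hconv : X * (z + d) + X * (κ * d ^ 2) ≤ z + X * d := by
    calc X * (z + d) + X * (κ * d ^ 2)
        = X * ζ * (branchSum w z₀ + ENNReal.ofReal (w (n + 3)) * (d ^ 2 * z₀ ^ n)) := by
          rw [← hd]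
          nth_rewrite 1 [hz₀]
          rw [treeSum_eq, ← hz₀, hκ]
          ring
      _ ≤ X * ζ * (branchSum w z + d * branchDerivSum w z₀) := by
          gcongr X * ζ * ?_
          have := branchSum_add_sq_le w z d n
          rwa [← hd] at this
      _ = X * ζ * branchSum w z + X * d * (ζ * branchDerivSum w z₀) := by ring
      _ = z + X * d := by rw [hcrit, mul_one, hz, ← treeSum_eq]
  have hreal : x * (z.toReal + d.toReal) + x * (κ.toReal * d.toReal ^ 2) ≤
      z.toReal + x * d.toReal := by
    have := (ENNReal.toReal_le_toReal (by finiteness) (by finiteness)).2 hconv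
    rw [ENNReal.toReal_add (by finiteness) (by finiteness),
      ENNReal.toReal_add (by finiteness) (by finiteness)] at this
    simpa [ENNReal.toReal_add hzt' hdt, hX, ENNReal.toReal_ofReal hx0.le] using this
  have hzr : z.toReal ≤ z₀.toReal := (ENNReal.toReal_le_toReal hzt' hzt).2 hzz
  have hdsq : d.toReal ^ 2 ≤ b * (1 - x) := by
    rw [hb, div_mul_eq_mul_div, le_div_iff₀ hκr]
    have h₁ : x * (κ.toReal * d.toReal ^ 2) ≤ (1 - x) * z₀.toReal := by
      nlinarith
    have h₂ : 0 ≤ κ.toReal * d.toReal ^ 2 := by positivity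
    nlinarith
  have hdr : d.toReal ≤ √b * √(1 - x) := by
    rw [← Real.sqrt_mul hb0]
    exact Real.le_sqrt_of_sq_le hdsq
  have hsq : 1 - x ≤ √(1 - x) := by
    refine Real.le_sqrt_of_sq_le ?_
    nlinarith
  calc (1 : ℝ≥0∞) = X * (ζ * branchDerivSum w z₀) + ENNReal.ofReal (1 - x) := by
        rw [hcrit, mul_one, hX, ← ENNReal.ofReal_add hx0.le (by linarith)]
        simp
    _ ≤ X * (ζ * (branchDerivSum w z + d * M)) + ENNReal.ofReal (1 - x) := by
        gcongr
        have := branchDerivSum_add_le w (z := z) (d := d) hd.ge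
        rwa [← hd] at this
    _ = X * ζ * branchDerivSum w z + (X * (ζ * M * d) + ENNReal.ofReal (1 - x)) := by ring
    _ ≤ X * ζ * branchDerivSum w z + (1 * (ζ * M * d) + ENNReal.ofReal (1 - x)) := by gcongr
    _ = X * ζ * branchDerivSum w z + ENNReal.ofReal ((ζ * M).toReal * d.toReal + (1 - x)) := by
        rw [one_mul, ENNReal.ofReal_add (by positivity) (by linarith),
          ENNReal.ofReal_mul (by positivity), ENNReal.ofReal_toReal (by finiteness),
          ENNReal.ofReal_toReal hdt]
    _ ≤ _ := by
        gcongr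
        rw [add_mul, one_mul, mul_assoc]
        gcongr

end PlanarTree

namespace PlanarTree

/-! ### Balls in the space of trees -/

theorem mem_ball_self (R : ℕ) (T : PlanarTree) : T ∈ ball R T := fun _ _ => Iff.rfl

theorem mem_ball_symm {R : ℕ} {T T' : PlanarTree} (h : T' ∈ ball R T) : T ∈ ball R T' :=
  fun v hv => (h v hv).symm

theorem mem_ball_trans {R : ℕ} {T T' T'' : PlanarTree} (h : T'' ∈ ball R T') (h' : T' ∈ ball R T) :
    T'' ∈ ball R T := fun v hv => (h v hv).trans (h' v hv)

theorem finite_setOf_mem_body_length_le (T : PlanarTree) (R : ℕ) :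
    {v | v ∈ T.body ∧ v.length ≤ R}.Finite := by
  induction R with
  | zero =>
    refine (Set.finite_singleton []).subset ?_
    rintro v ⟨-, hv⟩
    exact List.length_eq_zero_iff.1 (Nat.le_zero.1 hv)
  | succ R ih =>
    refine ((Set.finite_singleton []).union
      (ih.biUnion fun v _ => (T.finite_children v).image fun i => v ++ [i])).subset ?_
    rintro v ⟨hv, hl⟩
    rcases List.eq_nil_or_concat v with rfl | ⟨u, i, rfl⟩
    · exact Or.inl rfl
    · rw [List.concat_eq_append] at hv hl ⊢
      refine Or.inr (Set.mem_biUnion (x := u) ⟨mem_body_of_append_singleton hv, ?_⟩ ⟨i, hv, rfl⟩)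
      simpa using hl

/-- The tree consisting of the vertices of height at most `R + 1`. -/
def trunc (R : ℕ) (T : PlanarTree) : PlanarTree :=
  ofBody {v | v ∈ T.body ∧ v.length ≤ R} ⟨nil_mem_body T, by simp⟩
    (fun v i h => ⟨mem_body_of_append_singleton h.1, by have := h.2; simp at this; omega⟩)
    (fun v i j hij h => ⟨left_mem_body hij h.1, by simpa using h.2⟩)
    (fun v => (T.finite_children v).subset fun i hi => hi.1)

theorem mem_ball_trunc (R : ℕ) (T : PlanarTree) : T ∈ ball (R + 1) (trunc R T) := by
  rw [mem_ball_succ]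
  intro v hv
  simp [trunc, hv]

/-- The trees of height at most `R + 1`. -/
def lowTrees (R : ℕ) : Set PlanarTree := {T | ∀ v ∈ T.body, v.length ≤ R}

theorem trunc_mem_lowTrees (R : ℕ) (T : PlanarTree) : trunc R T ∈ lowTrees R := by
  intro v hv
  simp only [trunc, body_ofBody] at hv
  exact hv.2

theorem finite_body_of_mem_lowTrees {R : ℕ} {T : PlanarTree} (h : T ∈ lowTrees R) :
    T.body.Finite :=
  (T.finite_setOf_mem_body_length_le R).subset fun v hv => ⟨hv, h v hv⟩

theorem countable_lowTrees (R : ℕ) : (lowTrees R).Countable :=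
  countable_setOf_finite_body.mono fun _ hT => finite_body_of_mem_lowTrees hT

theorem exists_mem_lowTrees {T : PlanarTree} (h : T.body.Finite) : ∃ R, T ∈ lowTrees R := by
  obtain ⟨R, hR⟩ := (h.image List.length).bddAbove
  exact ⟨R, fun v hv => hR ⟨v, hv, rfl⟩⟩

theorem eq_of_mem_ball {R : ℕ} {T T' : PlanarTree} (hT : T ∈ lowTrees R) (hT' : T' ∈ lowTrees R)
    (h : T' ∈ ball (R + 1) T) : T' = T := by
  rw [mem_ball_succ] at h
  refine body_injective (Set.ext fun v => ?_)
  by_cases hv : v.length ≤ R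
  · exact h v hv
  · exact iff_of_false (fun h => hv (hT' v h)) fun h => hv (hT v h)

/-- A low tree is determined by a ball of one more unit of radius, which shows that none of the
highest vertices has children. -/
theorem ball_eq_singleton {R : ℕ} {T : PlanarTree} (hT : T ∈ lowTrees R) :
    ball (R + 2) T = {T} := by
  refine Set.eq_singleton_iff_unique_mem.2 ⟨mem_ball_self _ _, fun T' h => ?_⟩
  rw [mem_ball_succ] at h
  refine eq_of_mem_ball hT ?_ (mem_ball_succ.2 fun v hv => h v (by omega))
  intro v hv
  by_contra hR
  have h₁ : v.take (R + 1) ∈ T'.body :=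
    mem_body_of_append (v := v.drop (R + 1)) (by rwa [List.take_append_drop])
  have h₂ := hT _ ((h _ (by simp)).1 h₁)
  simp at h₂
  omega

/-- A set of trees such that membership depends only on the vertices of height at most `R + 1`. -/
def DependsOnBall (R : ℕ) (A : Set PlanarTree) : Prop := ∀ T ∈ A, ball (R + 1) T ⊆ A

theorem DependsOnBall.compl {R : ℕ} {A : Set PlanarTree} (hA : DependsOnBall R A) :
    DependsOnBall R Aᶜ := fun _ hT _ hT' h => hT (hA _ h (mem_ball_symm hT'))

theorem DependsOnBall.eq_biUnion {R : ℕ} {A : Set PlanarTree} (hA : DependsOnBall R A) :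
    A = ⋃ T ∈ A ∩ lowTrees R, ball (R + 1) T := by
  refine Set.Subset.antisymm (fun T hT => ?_) (Set.iUnion₂_subset fun _ hT => hA _ hT.1)
  exact Set.mem_biUnion (x := trunc R T)
    ⟨hA T hT (mem_ball_symm (mem_ball_trunc R T)), trunc_mem_lowTrees R T⟩ (mem_ball_trunc R T)

theorem pairwiseDisjoint_ball (R : ℕ) (A : Set PlanarTree) :
    (A ∩ lowTrees R).PairwiseDisjoint (ball (R + 1)) := by
  intro T hT T' hT' hne
  refine Set.disjoint_left.2 fun S hS hS' => hne ?_
  exact eq_of_mem_ball hT'.2 hT.2 (mem_ball_trans (mem_ball_symm hS) hS')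

theorem measurableSet_ball (R : ℕ) (T : PlanarTree) : MeasurableSet (ball (R + 1) T) :=
  MeasurableSpace.measurableSet_generateFrom ⟨R + 1, T, by omega, rfl⟩

theorem DependsOnBall.measurableSet {R : ℕ} {A : Set PlanarTree} (hA : DependsOnBall R A) :
    MeasurableSet A := by
  rw [hA.eq_biUnion]
  exact .biUnion ((countable_lowTrees R).mono Set.inter_subset_right)
    fun T _ => measurableSet_ball R T

end PlanarTree

namespace MarkedTree
open PlanarTree

theorem exists_dependsOnBall_completions (p : MarkedTree) :
    ∃ R, DependsOnBall R p.completions := by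
  obtain ⟨R, hR⟩ := exists_mem_lowTrees p.finite
  refine ⟨R + 1, fun T hT T' hT' => ?_⟩
  rw [mem_ball_succ] at hT'
  refine ⟨(hT' _ ((hR _ p.mark_mem).trans (by omega))).2 hT.1, fun v hv => ?_⟩
  by_cases hl : v.length ≤ R + 1
  · rw [hT' v hl, hT.2 v hv]
  · refine iff_of_false (fun h => ?_) fun h => ?_
    · have h₁ : v.take (R + 1) ∈ T'.body :=
        mem_body_of_append (v := v.drop (R + 1)) (by rwa [List.take_append_drop])
      have h₂ := (hT.2 _ fun h' => hv (h'.trans (List.take_prefix _ _))).1 ((hT' _ (by simp)).1 h₁)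
      have h₃ := hR _ h₂
      simp at h₃
      omega
    · have := hR _ h
      omega

theorem measurableSet_completions (p : MarkedTree) : MeasurableSet p.completions := by
  obtain ⟨R, hR⟩ := p.exists_dependsOnBall_completions
  exact hR.measurableSet

instance : Countable MarkedTree := by
  have := countable_setOf_finite_body.to_subtype
  refine Function.Injective.countable
    (f := fun p : MarkedTree =>
      ((⟨p.tree, p.finite⟩ : {T : PlanarTree | T.body.Finite}), p.mark)) ?_
  rintro ⟨T, v, h₁, h₂, h₃⟩ ⟨T', v', h₁', h₂', h₃'⟩ h
  simp only [Prod.mk.injEq, Subtype.mk.injEq] at h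
  obtain ⟨rfl, rfl⟩ := h
  rfl

end MarkedTree

namespace PlanarTree

/-! ### The finite volume distributions and their limit -/

theorem finiteVolumeProb_eq (w : ℕ → ℝ) (N : ℕ) (A : Set PlanarTree) :
    finiteVolumeProb w N A =
      (partitionFunction w N)⁻¹ * ∑ᶠ T ∈ ofSize N ∩ A, T.weight w :=
  (mul_finsum_mem _ _).symm

theorem finsum_mem_ofSize_inter_le {w : ℕ → ℝ} (hw : ∀ n, 1 ≤ n → 0 ≤ w n) (N : ℕ)
    (A : Set PlanarTree) :
    ∑ᶠ T ∈ ofSize N ∩ A, T.weight w ≤ partitionFunction w N := by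
  rw [partitionFunction_eq, finsum_mem_eq_finite_toFinset_sum _
    ((finite_ofSize N).subset Set.inter_subset_left)]
  refine Finset.sum_le_sum_of_subset_of_nonneg ?_ fun T _ _ => weight_nonneg hw T
  simp [Set.inter_subset_left]

/-- The finite volume distributions are finitely additive. -/
theorem sum_finiteVolumeProb_add_le {w : ℕ → ℝ} (hw : ∀ n, 1 ≤ n → 0 ≤ w n) (N : ℕ) {ι : Type*}
    (s : Finset ι) (B : ι → Set PlanarTree) (hB : (s : Set ι).PairwiseDisjoint B)
    (A : Set PlanarTree) (hA : ∀ i ∈ s, Disjoint (B i) A) :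
    ∑ i ∈ s, finiteVolumeProb w N (B i) + finiteVolumeProb w N A ≤ 1 := by
  have hfin : ∀ C, (ofSize N ∩ C).Finite := fun C =>
    (finite_ofSize N).subset Set.inter_subset_left
  have h₁ : ∑ i ∈ s, ∑ᶠ T ∈ ofSize N ∩ B i, T.weight w =
      ∑ᶠ T ∈ ofSize N ∩ ⋃ i ∈ s, B i, T.weight w := by
    rw [Set.inter_iUnion₂, ← finsum_mem_coe_finset]
    symm
    exact finsum_mem_biUnion (hB.mono fun i => Set.inter_subset_right) s.finite_toSet
      fun i _ => hfin _
  simp_rw [finiteVolumeProb_eq]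
  rw [← Finset.mul_sum, h₁, ← mul_add, ← finsum_mem_union _ (hfin _) (hfin _),
    ← Set.inter_union_distrib_left]
  · calc _ ≤ (partitionFunction w N)⁻¹ * partitionFunction w N := by
          gcongr
          · exact inv_nonneg.2 (partitionFunction_nonneg hw N)
          · exact finsum_mem_ofSize_inter_le hw N _
      _ ≤ 1 := inv_mul_le_one
  · refine Disjoint.mono Set.inter_subset_right Set.inter_subset_right ?_
    exact Set.disjoint_iUnion₂_left.2 hA

/-- The finite volume distributions being probabilities which converge, on the countable partition
into balls, to a probability, no mass is lost in the limit. -/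
theorem IsInfiniteVolumeLimit.eventually_finiteVolumeProb_lt {w : ℕ → ℝ} {ν : Measure PlanarTree}
    (hν : IsInfiniteVolumeLimit w ν) (hw : ∀ n, 1 ≤ n → 0 ≤ w n) {R : ℕ} {A : Set PlanarTree}
    (hA : DependsOnBall R A) {q : ℝ} (hq : ν.real A < q) :
    ∀ᶠ N in atTop ⊓ 𝓟 {N | partitionFunction w N ≠ 0}, finiteVolumeProb w N A < q := by
  have := hν.isProbabilityMeasure
  -- It suffices to find finitely many balls in the complement of `A` of total probability above
  -- `1 - q`: their finite volume probabilities converge.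
  have hcount : (Aᶜ ∩ lowTrees R).Countable := (countable_lowTrees R).mono Set.inter_subset_right
  have h₁ : ν Aᶜ = ∑' T : ↥(Aᶜ ∩ lowTrees R), ν (ball (R + 1) T.1) := by
    conv_lhs => rw [hA.compl.eq_biUnion]
    exact measure_biUnion hcount (pairwiseDisjoint_ball R _) fun T _ => measurableSet_ball R T
  have h₂ : HasSum (fun T : ↥(Aᶜ ∩ lowTrees R) => ν.real (ball (R + 1) T.1)) (1 - ν.real A) := by
    have := ENNReal.hasSum_toReal (h₁ ▸ measure_ne_top ν Aᶜ)
    rwa [← ENNReal.tsum_toReal_eq fun _ => measure_ne_top _ _, ← h₁, ← measureReal_def,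
      probReal_compl_eq_one_sub hA.measurableSet] at this
  obtain ⟨s, hs⟩ := (h₂.eventually_const_lt (by linarith : 1 - q < 1 - ν.real A)).exists
  have h₃ : Tendsto (fun N => ∑ T ∈ s, finiteVolumeProb w N (ball (R + 1) T.1))
      (atTop ⊓ 𝓟 {N | partitionFunction w N ≠ 0}) (𝓝 (∑ T ∈ s, ν.real (ball (R + 1) T.1))) :=
    tendsto_finsetSum _ fun T _ => hν.tendsto_ball (R + 1) T.1 (by omega)
  filter_upwards [h₃.eventually_const_lt hs] with N hN
  have := sum_finiteVolumeProb_add_le hw N s (fun T => ball (R + 1) T.1)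
    (fun T _ T' _ hne => pairwiseDisjoint_ball R _ T.2 T'.2 fun h => hne (Subtype.ext h)) A
    (fun T _ => Set.disjoint_left.2 fun S hS hSA => hA.compl T.1 T.2.1 hS hSA)
  linarith

theorem frequently_partitionFunction_ne_zero {w : ℕ → ℝ} (hw : IsGeneric w) :
    ∃ᶠ N in atTop, partitionFunction w N ≠ 0 := by
  intro h
  obtain ⟨n, hn⟩ := eventually_atTop.1 h
  refine zetaCrit_ne_top hw (ENNReal.eq_top_of_forall_nnreal_le fun r => ?_)
  refine le_zetaCrit hw.nonneg ENNReal.coe_ne_top ?_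
  rw [treeSum_eq_tsum hw.nonneg, tsum_eq_sum (s := Finset.range n)]
  · exact ENNReal.sum_ne_top.2 fun N _ => by finiteness
  · intro N hN
    rw [not_not.1 (hn N (by simpa using hN))]
    simp

theorem neBot_support {w : ℕ → ℝ} (hw : IsGeneric w) :
    (atTop ⊓ 𝓟 {N | partitionFunction w N ≠ 0}).NeBot := by
  rw [← frequently_mem_iff_neBot]
  exact frequently_partitionFunction_ne_zero hw

theorem IsInfiniteVolumeLimit.ae_infinite {w : ℕ → ℝ} {ν : Measure PlanarTree}
    (hν : IsInfiniteVolumeLimit w ν) (hw : IsGeneric w) :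
    ∀ᵐ T ∂ν, T.body.Infinite := by
  have := hν.isProbabilityMeasure
  have := neBot_support hw
  have h : ν {T | T.body.Finite} = 0 := by
    rw [← Set.biUnion_of_singleton {T : PlanarTree | T.body.Finite},
      measure_biUnion_null_iff countable_setOf_finite_body]
    intro T hT
    obtain ⟨R, hR⟩ := exists_mem_lowTrees hT
    have h₁ := hν.tendsto_ball (R + 2) T (by omega)
    rw [ball_eq_singleton hR] at h₁
    have h₂ : Tendsto (fun N => finiteVolumeProb w N {T})
        (atTop ⊓ 𝓟 {N | partitionFunction w N ≠ 0}) (𝓝 0) := by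
      refine (tendsto_const_nhds.congr' ?_).mono_left inf_le_left
      filter_upwards [eventually_gt_atTop T.body.ncard] with N hN
      have : ofSize N ∩ {T} = ∅ := by
        rw [Set.inter_singleton_eq_empty]
        exact fun h => hN.ne (mem_ofSize.1 h).2
      simp [finiteVolumeProb, this]
    have h₃ := tendsto_nhds_unique h₁ h₂
    rwa [measureReal_eq_zero_iff] at h₃
  rw [ae_iff]
  simp_rw [Set.not_infinite]
  exact h

end PlanarTree

namespace MarkedTree
open PlanarTree

theorem ncard_body_pos (p : MarkedTree) : 0 < p.tree.body.ncard :=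
  PlanarTree.ncard_body_pos p.finite

/-- Grafting identifies the completions of size `(|τ| - 1) + n` with the trees of size `n`. -/
theorem finsum_mem_ofSize_inter_completions {w : ℕ → ℝ} (hw : w 1 ≠ 0) (p : MarkedTree) (n : ℕ) :
    ∑ᶠ T ∈ ofSize (p.tree.body.ncard - 1 + n) ∩ p.completions, T.weight w =
      p.tree.weight w / w 1 * partitionFunction w n := by
  have hpos := p.ncard_body_pos
  have himg : ofSize (p.tree.body.ncard - 1 + n) ∩ p.completions = p.graft '' ofSize n := by
    ext T
    constructor
    · rintro ⟨hT, hc⟩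
      obtain ⟨S, -, rfl⟩ := p.bijOn_graft.surjOn hc
      rw [mem_ofSize, finite_body_graft] at hT
      have := ncard_body_graft p hT.1
      exact ⟨S, mem_ofSize.2 ⟨hT.1, by omega⟩, rfl⟩
    · rintro ⟨S, hS, rfl⟩
      rw [mem_ofSize] at hS
      have := ncard_body_graft p hS.1
      exact ⟨mem_ofSize.2 ⟨finite_body_graft.2 hS.1, by omega⟩, p.bijOn_graft.mapsTo trivial⟩
  rw [himg, finsum_mem_image (p.bijOn_graft.injOn.mono (Set.subset_univ _)), partitionFunction,
    mul_finsum_mem]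
  refine finsum_mem_congr rfl fun S hS => ?_
  have h := prodBody_graft (fun n => w (n + 1)) p (mem_ofSize.1 hS).1
  rw [← weight_eq_prodBody, ← weight_eq_prodBody, ← weight_eq_prodBody, zero_add] at h
  field_simp
  linarith

/-- The weight `ζ ^ |T| ∏ w_{σ_v}` of a marked tree, without the factors `ζ` and `w₁` of the marked
leaf, which is a placeholder for a tree to be grafted. -/
noncomputable def mass (w : ℕ → ℝ) (ζ : ℝ≥0∞) (p : MarkedTree) : ℝ≥0∞ :=
  fugacityWeight w ζ p.tree / (ζ * ENNReal.ofReal (w 1))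

theorem mass_eq {w : ℕ → ℝ} (hw : IsGeneric w) {ζ : ℝ≥0∞} (hζ : ζ ≠ 0) (hζt : ζ ≠ ∞)
    (p : MarkedTree) :
    p.mass w ζ = ENNReal.ofReal (p.tree.weight w / w 1) * ζ ^ (p.tree.body.ncard - 1) := by
  have hpos := p.ncard_body_pos
  have h1 := ENNReal.ofReal_pos.2 hw.one_pos
  have hp : ζ ^ p.tree.body.ncard = ζ ^ (p.tree.body.ncard - 1) * ζ := by
    rw [← pow_succ]
    congr 1
    omega
  rw [mass, fugacityWeight_eq hw.nonneg p.finite, ENNReal.ofReal_div_of_pos hw.one_pos, hp,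
    ENNReal.div_eq_inv_mul, ENNReal.div_eq_inv_mul, ENNReal.mul_inv (Or.inl hζ) (Or.inl hζt)]
  calc _ = (ENNReal.ofReal (w 1))⁻¹ * ENNReal.ofReal (p.tree.weight w) *
        ζ ^ (p.tree.body.ncard - 1) * (ζ⁻¹ * ζ) := by ring
    _ = _ := by rw [ENNReal.inv_mul_cancel hζ hζt, mul_one]

/-- If the completions of `p`, which share `m` edges, had a smaller probability than
`mass w ζ₀ p`, then `Z_{n + m} ζ₀ ^ (n + m)` would exceed `Z_n ζ₀ ^ n` by a factor larger than `1`
for all large `n`, and `Z(ζ₀)` would be infinite. -/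
theorem mass_le_measure_completions {w : ℕ → ℝ} (hw : IsGeneric w) {ν : Measure PlanarTree}
    (hν : IsInfiniteVolumeLimit w ν) (p : MarkedTree) :
    p.mass w (zetaCrit w) ≤ ν p.completions := by
  have := hν.isProbabilityMeasure
  by_contra! hlt
  set m := p.tree.body.ncard - 1 with hm
  set W := p.tree.weight w / w 1 with hW
  have hW0 : 0 ≤ W := div_nonneg (weight_nonneg hw.nonneg _) hw.one_pos.le
  set ζ := (zetaCrit w).toReal with hζ
  have hζ0 : 0 < ζ := ENNReal.toReal_pos (zetaCrit_pos hw).ne' (zetaCrit_ne_top hw)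
  have hmass : p.mass w (zetaCrit w) = ENNReal.ofReal (W * ζ ^ m) := by
    rw [mass_eq hw (zetaCrit_pos hw).ne' (zetaCrit_ne_top hw), ENNReal.ofReal_mul hW0,
      ENNReal.ofReal_pow hζ0.le, ofReal_toReal_zetaCrit hw]
  rw [hmass, ← ofReal_measureReal, ENNReal.ofReal_lt_ofReal_iff_of_nonneg measureReal_nonneg] at hlt
  obtain ⟨q, hq₁, hq₂⟩ := exists_between hlt
  have hq0 : 0 < q := measureReal_nonneg.trans_lt hq₁
  obtain ⟨R, hR⟩ := p.exists_dependsOnBall_completions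
  have hev := hν.eventually_finiteVolumeProb_lt hw.nonneg hR hq₁
  rw [eventually_inf_principal, eventually_atTop] at hev
  obtain ⟨n₀, hn₀⟩ := hev
  have hZ0 := partitionFunction_nonneg hw.nonneg
  set b : ℕ → ℝ := fun n => partitionFunction w n * ζ ^ n with hb
  have hb0 : ∀ n, 0 ≤ b n := fun n => mul_nonneg (hZ0 n) (pow_nonneg hζ0.le n)
  have hstep : ∀ n, n₀ ≤ n → W * partitionFunction w n ≤ q * partitionFunction w (m + n) := by
    intro n hn
    have hgraft := finsum_mem_ofSize_inter_completions hw.one_pos.ne' p n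
    rcases (hZ0 (m + n)).eq_or_lt with h0 | h0
    · have := finsum_mem_ofSize_inter_le hw.nonneg (m + n) p.completions
      rw [hgraft, ← h0] at this
      rw [← h0, mul_zero]
      exact this
    · have := hn₀ (m + n) (by omega) h0.ne'
      rw [finiteVolumeProb_eq, hgraft, inv_mul_lt_iff₀ h0] at this
      linarith
  set κ := W * ζ ^ m / q with hκ
  have hκ1 : 1 < κ := (one_lt_div hq0).2 hq₂
  have hbstep : ∀ n, n₀ ≤ n → κ * b n ≤ b (m + n) := by
    intro n hn
    rw [hκ, div_mul_eq_mul_div, div_le_iff₀ hq0]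
    calc W * ζ ^ m * b n = W * partitionFunction w n * (ζ ^ m * ζ ^ n) := by rw [hb]; ring
      _ ≤ q * partitionFunction w (m + n) * (ζ ^ m * ζ ^ n) := by
          gcongr ?_ * _
          exact hstep n hn
      _ = b (m + n) * q := by simp only [hb]; rw [pow_add]; ring
  have hiter : ∀ n, n₀ ≤ n → ∀ j, κ ^ j * b n ≤ b (j * m + n) := by
    intro n hn j
    induction j with
    | zero => simp
    | succ j ih =>
      calc κ ^ (j + 1) * b n = κ * (κ ^ j * b n) := by ring
        _ ≤ κ * b (j * m + n) := by gcongr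
        _ ≤ b (m + (j * m + n)) := hbstep _ (by omega)
        _ = _ := by congr 1; ring
  have hfin : ∑' N, ENNReal.ofReal (b N) ≠ ∞ := by
    have h := treeSum_zetaCrit_ne_top hw
    rw [treeSum_eq_tsum hw.nonneg] at h
    convert h using 3 with N
    rw [ENNReal.ofReal_mul (hZ0 N), ENNReal.ofReal_pow hζ0.le, ofReal_toReal_zetaCrit hw]
  have hbdd : ∀ n, b n ≤ (∑' N, ENNReal.ofReal (b N)).toReal := by
    intro n
    have := ENNReal.toReal_mono hfin (ENNReal.le_tsum (f := fun N => ENNReal.ofReal (b N)) n)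
    rwa [ENNReal.toReal_ofReal (hb0 n)] at this
  obtain ⟨n, hn, hn0⟩ := (frequently_atTop.1 (frequently_partitionFunction_ne_zero hw)) n₀
  have hbn : 0 < b n := mul_pos ((hZ0 n).lt_of_ne' hn0) (pow_pos hζ0 n)
  obtain ⟨j, hj⟩ := pow_unbounded_of_one_lt ((∑' N, ENNReal.ofReal (b N)).toReal / b n) hκ1
  rw [div_lt_iff₀ hbn] at hj
  exact absurd (hj.trans_le ((hiter n hn j).trans (hbdd _))) (lt_irrefl _)

end MarkedTree

namespace MarkedTree
open PlanarTree

/-! ### The limit as a measure on trees with a spine -/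

theorem tsum_mass {w : ℕ → ℝ} (hw : IsGeneric w) {ζ : ℝ≥0∞} (hζ : ζ ≠ 0) (hζt : ζ ≠ ∞) (K : ℕ) :
    ∑' p : {p : MarkedTree // p.mark.length = K}, p.1.mass w ζ =
      (ζ * branchDerivSum w (treeSum w ζ)) ^ K := by
  have h1 := ENNReal.ofReal_pos.2 hw.one_pos
  let e : {p : MarkedTree // p.mark.length = K} → (T : PlanarTree) × T.leavesAt K := fun p =>
    ⟨p.1.tree, p.1.mark, p.2, p.1.mark_mem, p.1.isLeaf⟩
  have he : Function.Injective e := by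
    rintro ⟨⟨T, v, h₁, h₂, h₃⟩, h₄⟩ ⟨⟨T', v', h₁', h₂', h₃'⟩, h₄'⟩ h
    simp only [e, Sigma.mk.injEq] at h
    obtain ⟨rfl, h⟩ := h
    obtain rfl : v = v' := congrArg Subtype.val (eq_of_heq h)
    rfl
  have hsum : ∑' p : {p : MarkedTree // p.mark.length = K}, fugacityWeight w ζ p.1.tree =
      ∑' T, fugacityWeight w ζ T * numLeaves K T := by
    refine (he.tsum_eq (f := fun x => fugacityWeight w ζ x.1) ?_).trans ?_
    rotate_left
    · rw [ENNReal.tsum_sigma']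
      refine tsum_congr fun T => ?_
      rw [numLeaves, ← ENNReal.tsum_mul_left]
      simp
    · rintro ⟨T, v, h₁, h₂, h₃⟩ hx
      by_cases hT : T.body.Finite
      · exact ⟨⟨⟨T, v, hT, h₂, h₃⟩, h₁⟩, rfl⟩
      · exact absurd (if_neg hT) hx
  simp_rw [mass, div_eq_mul_inv]
  rw [ENNReal.tsum_mul_right, hsum, tsum_fugacityWeight_mul_numLeaves, mul_assoc,
    ENNReal.mul_inv_cancel (mul_ne_zero hζ h1.ne') (by finiteness), mul_one]

/-- If both `p` and `p'` complete to the infinite tree `T`, then infinitely many vertices of `T`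
descend from both marked leaves. -/
theorem mark_prefix_mark {p p' : MarkedTree} {T : PlanarTree} (hT : T.body.Infinite)
    (hp : T ∈ p.completions) (hp' : T ∈ p'.completions) (hl : p.mark.length ≤ p'.mark.length) :
    p.mark <+: p'.mark := by
  by_contra hn
  refine hT ((p.finite.union p'.finite).subset fun v hv => ?_)
  by_cases h : p.mark <+: v
  · refine Or.inr ((hp'.2 v fun h' => hn ?_).1 hv)
    exact List.prefix_of_prefix_length_le h h' hl
  · exact Or.inl ((hp.2 v h).1 hv)

theorem eq_of_mem_completions {p p' : MarkedTree} {T : PlanarTree} (hT : T.body.Infinite)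
    (hp : T ∈ p.completions) (hp' : T ∈ p'.completions) (hl : p.mark.length = p'.mark.length) :
    p = p' := by
  have hm : p.mark = p'.mark := (mark_prefix_mark hT hp hp' hl.le).eq_of_length hl
  have ht : p.tree = p'.tree := by
    refine body_injective (Set.ext fun v => ?_)
    by_cases h : p.mark <+: v
    · constructor
      · intro hv
        rw [eq_mark hv h, hm]
        exact p'.mark_mem
      · intro hv
        rw [eq_mark hv (hm ▸ h), ← hm]
        exact p.mark_mem
    · rw [← hp.2 v h, hp'.2 v (hm ▸ h)]
  obtain ⟨T, v, h₁, h₂, h₃⟩ := p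
  obtain ⟨T', v', h₁', h₂', h₃'⟩ := p'
  simp only at hm ht
  subst hm ht
  rfl

theorem tsum_measure_completions {w : ℕ → ℝ} (hw : IsGeneric w) {ν : Measure PlanarTree}
    (hν : IsInfiniteVolumeLimit w ν) (K : ℕ) :
    ∑' p : {p : MarkedTree // p.mark.length = K}, ν p.1.completions =
      ν (⋃ p : {p : MarkedTree // p.mark.length = K}, p.1.completions) := by
  refine (measure_iUnion₀ (fun p p' hne => ?_)
    fun p => p.1.measurableSet_completions.nullMeasurableSet).symm
  refine measure_mono_null (t := {T | T.body.Infinite}ᶜ) ?_ (hν.ae_infinite hw)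
  rintro T ⟨hp, hp'⟩ hT
  exact hne (Subtype.ext (eq_of_mem_completions hT hp hp' (p.2.trans p'.2.symm)))

/-- Of criticality, `ζ₀ φ'(Z(ζ₀)) ≤ 1` follows from the existence of the limit: the
events `p.completions`, with marks at height `2`, are almost surely disjoint. -/
theorem zetaCrit_mul_branchDerivSum {w : ℕ → ℝ} (hw : IsGeneric w) {ν : Measure PlanarTree}
    (hν : IsInfiniteVolumeLimit w ν) :
    zetaCrit w * branchDerivSum w (treeSum w (zetaCrit w)) = 1 := by
  have := hν.isProbabilityMeasure
  refine le_antisymm ?_ (one_le_zetaCrit_mul_branchDerivSum hw)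
  rw [← pow_one (_ * _), ← tsum_mass hw (zetaCrit_pos hw).ne' (zetaCrit_ne_top hw)]
  calc _ ≤ ∑' p : {p : MarkedTree // p.mark.length = 1}, ν p.1.completions :=
        ENNReal.tsum_le_tsum fun p => p.1.mass_le_measure_completions hw hν
    _ ≤ 1 := by rw [tsum_measure_completions hw hν]; exact prob_le_one

theorem tsum_mass_zetaCrit {w : ℕ → ℝ} (hw : IsGeneric w) {ν : Measure PlanarTree}
    (hν : IsInfiniteVolumeLimit w ν) (K : ℕ) :
    ∑' p : {p : MarkedTree // p.mark.length = K}, p.1.mass w (zetaCrit w) = 1 := by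
  rw [tsum_mass hw (zetaCrit_pos hw).ne' (zetaCrit_ne_top hw), zetaCrit_mul_branchDerivSum hw hν,
    one_pow]

/-- The lower bounds `mass w ζ₀ p` for the probabilities of almost disjoint events add up to `1`. -/
theorem measure_completions {w : ℕ → ℝ} (hw : IsGeneric w) {ν : Measure PlanarTree}
    (hν : IsInfiniteVolumeLimit w ν) (p : MarkedTree) :
    ν p.completions = p.mass w (zetaCrit w) := by
  have := hν.isProbabilityMeasure
  refine le_antisymm (not_lt.1 fun hlt => ?_) (p.mass_le_measure_completions hw hν)
  have h₁ : ∑' q : {q : MarkedTree // q.mark.length = p.mark.length}, q.1.mass w (zetaCrit w) <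
      ∑' q : {q : MarkedTree // q.mark.length = p.mark.length}, ν q.1.completions :=
    ENNReal.tsum_lt_tsum (i := ⟨p, rfl⟩) (by rw [tsum_mass_zetaCrit hw hν]; simp)
      (fun q => q.1.mass_le_measure_completions hw hν) hlt
  rw [tsum_mass_zetaCrit hw hν, tsum_measure_completions hw hν] at h₁
  exact h₁.not_ge prob_le_one

theorem ae_exists_mem_completions {w : ℕ → ℝ} (hw : IsGeneric w) {ν : Measure PlanarTree}
    (hν : IsInfiniteVolumeLimit w ν) :
    ∀ᵐ T ∂ν, ∀ K : ℕ, ∃ p : MarkedTree, p.mark.length = K ∧ T ∈ p.completions := by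
  have := hν.isProbabilityMeasure
  refine ae_all_iff.2 fun K => ?_
  have h : ν (⋃ p : {p : MarkedTree // p.mark.length = K}, p.1.completions) = 1 := by
    rw [← tsum_measure_completions hw hν, ← tsum_mass_zetaCrit hw hν K]
    exact tsum_congr fun p => measure_completions hw hν p.1
  rw [← mem_ae_iff_prob_eq_one (.iUnion fun p => p.1.measurableSet_completions)] at h
  filter_upwards [h] with T hT
  obtain ⟨p, hp⟩ := Set.mem_iUnion.1 hT
  exact ⟨p.1, p.2, hp⟩

end MarkedTree

namespace PlanarTree

/-! ### Spines -/

theorem IsSpine.length_and_succ {T : PlanarTree} {s : ℕ → T.verts} (hs : T.IsSpine s) (n : ℕ) :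
    (s n).1.length = n ∧ ∃ i, (s (n + 1)).1 = (s n).1 ++ [i] := by
  induction n with
  | zero =>
    have h0 : (s 0).1 = [] := congrArg Subtype.val hs.1
    refine ⟨by simp [h0], ?_⟩
    rcases hs.2.1 0 with h | ⟨i, h⟩
    · exact h
    · simp [h0] at h
  | succ n ih =>
    obtain ⟨hl, i, hi⟩ := ih
    refine ⟨by simp [hi, hl], ?_⟩
    rcases hs.2.1 (n + 1) with h | ⟨j, h⟩
    · exact h
    · exact absurd (Subtype.ext (List.append_inj' (h.symm.trans hi) rfl).1) (hs.2.2 n)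

theorem IsSpine.prefix {T : PlanarTree} {s : ℕ → T.verts} (hs : T.IsSpine s) {m n : ℕ}
    (hmn : m ≤ n) : (s m).1 <+: (s n).1 := by
  induction n, hmn using Nat.le_induction with
  | base => exact List.prefix_rfl
  | succ n _ ih =>
    obtain ⟨i, hi⟩ := (hs.length_and_succ n).2
    exact ih.trans (hi ▸ List.prefix_append _ _)

theorem mem_verts_of_mem_completions {p : MarkedTree} {T : PlanarTree} (hp : T ∈ p.completions)
    {v : List ℕ} (hv : v ∈ T.verts) (h : ¬ 0 :: p.mark <+: v) : v ∈ p.tree.verts := by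
  rw [mem_verts_iff] at hv ⊢
  rcases hv with rfl | ⟨u, hu, rfl⟩
  · exact Or.inl rfl
  · exact Or.inr ⟨u, (hp.2 u fun h' => h ((List.cons_prefix_cons).2 ⟨rfl, h'⟩)).1 hu, rfl⟩

/-- A spine passes through the marked leaf, as the other branches are finite. -/
theorem IsSpine.eq_cons_mark {T : PlanarTree} {s : ℕ → T.verts} (hs : T.IsSpine s)
    {p : MarkedTree} (hp : T ∈ p.completions) : (s (p.mark.length + 1)).1 = 0 :: p.mark := by
  set K := p.mark.length
  by_contra hne
  have hlen := fun n => (hs.length_and_succ n).1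
  have hn : ∀ n, ¬ 0 :: p.mark <+: (s (K + 1 + n)).1 := by
    intro n h
    have h' : 0 :: p.mark <+: (s (K + 1)).1 := by
      refine List.prefix_of_prefix_length_le h (hs.prefix (by omega)) ?_
      rw [hlen]
      simp [K]
    exact hne (h'.eq_of_length (by rw [hlen]; simp [K])).symm
  have hfin : p.tree.verts.Finite := by
    refine ((Set.finite_singleton []).union (p.finite.image (List.cons 0))).subset fun v hv => ?_
    rcases mem_verts_iff.1 hv with rfl | ⟨u, hu, rfl⟩
    · exact Or.inl rfl
    · exact Or.inr ⟨u, hu, rfl⟩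
  refine Set.infinite_of_injective_forall_mem (f := fun n => (s (K + 1 + n)).1) (fun m n h => ?_)
    (fun n => mem_verts_of_mem_completions hp (s _).2 (hn n)) hfin
  have := congrArg List.length h
  simp only [hlen] at this
  omega

theorem existsUnique_isSpine {T : PlanarTree} (hT : T.body.Infinite)
    (h : ∀ K : ℕ, ∃ p : MarkedTree, p.mark.length = K ∧ T ∈ p.completions) :
    ∃! s : ℕ → T.verts, T.IsSpine s := by
  choose p hl hp using h
  have hsucc : ∀ n, ∃ i, (p (n + 1)).mark = (p n).mark ++ [i] := by
    intro n
    obtain ⟨u, hu⟩ := MarkedTree.mark_prefix_mark hT (hp n) (hp (n + 1)) (by simp [hl])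
    have := congrArg List.length hu
    rw [List.length_append, hl, hl] at this
    obtain ⟨i, rfl⟩ := List.length_eq_one_iff.1 (by omega : u.length = 1)
    exact ⟨i, hu.symm⟩
  let s : ℕ → T.verts := fun n => Nat.casesOn n T.root fun n => ⟨0 :: (p n).mark, (hp n).1⟩
  refine ⟨s, ⟨rfl, fun n => ?_, fun n h => ?_⟩, fun s' hs' => ?_⟩
  · rcases n with _ | n
    · refine Or.inl ⟨0, ?_⟩
      have := List.length_eq_zero_iff.1 (hl 0)
      simp [s, root, this]
    · obtain ⟨i, hi⟩ := hsucc n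
      exact Or.inl ⟨i, by simp [s, hi]⟩
  · have := congrArg (fun v : T.verts => v.1.length) h
    rcases n with _ | n
    · simp [s, root] at this
    · simp [s, hl] at this
  · funext n
    rcases n with _ | n
    · exact hs'.1
    · refine Subtype.ext ?_
      have := hs'.eq_cons_mark (hp n)
      rwa [hl] at this

/-- The closure of `G_0^K` consists of the branches up to and including the spine vertex `s_{K+1}`,
which is the marked leaf. -/
theorem truncationClosureSize_le {T : PlanarTree} {s : ℕ → T.verts} (hs : T.IsSpine s)
    {p : MarkedTree} (hp : T ∈ p.completions) :
    T.truncationClosureSize s p.mark.length ≤ p.tree.size := by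
  set K := p.mark.length
  have hmark : (s (K + 1)).1 = 0 :: p.mark := hs.eq_cons_mark hp
  have htr : ∀ v ∈ T.truncationVerts s K, ¬ 0 :: p.mark <+: v.1 := by
    intro v hv h
    obtain ⟨i, hi, -, hv⟩ := Set.mem_iUnion₂.1 hv
    rw [← hmark] at h
    exact hv ((hs.prefix (by have := hi.2; omega)).trans h)
  have hsub : ∀ v ∈ T.truncationVerts s K ∪ T.graph.outerBoundary (T.truncationVerts s K),
      v.1 ∈ p.tree.verts := by
    rintro v (hv | ⟨-, u, hu, h⟩)
    · exact mem_verts_of_mem_completions hp v.2 (htr v hv)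
    · have hu' := htr u hu
      by_cases hv : 0 :: p.mark <+: v.1
      · rcases h with ⟨i, hi⟩ | ⟨i, hi⟩
        · rw [hi] at hv ⊢
          rcases List.prefix_concat_iff.1 hv with hv | hv
          · rw [← List.concat_eq_append] at *
            rw [← hv]
            exact p.mark_mem
          · exact absurd hv hu'
        · exact absurd (hi ▸ hv.trans (List.prefix_append _ _)) hu'
      · exact mem_verts_of_mem_completions hp v.2 hv
  let f : T.graph.induce (T.truncationVerts s K ∪ T.graph.outerBoundary (T.truncationVerts s K)) →g
      p.tree.graph := ⟨fun v => ⟨v.1.1, hsub v.1 v.2⟩, fun h => h⟩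
  have hf : Function.Injective f := fun u v h => by
    have : u.1.1 = v.1.1 := congrArg (fun x : p.tree.verts => x.1) h
    exact Subtype.ext (Subtype.ext this)
  exact (⟨_, SimpleGraph.Hom.mapEdgeSet.injective f hf⟩ : Function.Embedding _ _).encard_le

end PlanarTree

/-! ### The tail of the size -/

/-- Bernoulli's inequality for `g = 1 - δ`, without subtraction. -/
theorem ENNReal.one_le_pow_add_mul {g δ : ℝ≥0∞} (hg : g ≤ 1) (h : 1 ≤ g + δ) (K : ℕ) :
    1 ≤ g ^ K + K * δ := by
  induction K with
  | zero => simp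
  | succ K ih =>
    calc 1 ≤ g * 1 + δ := by rwa [mul_one]
      _ ≤ g * (g ^ K + K * δ) + δ := by gcongr
      _ = g ^ (K + 1) + (g * (K * δ) + δ) := by ring
      _ ≤ g ^ (K + 1) + (1 * (K * δ) + δ) := by gcongr
      _ = _ := by push_cast; ring

namespace MarkedTree
open PlanarTree

theorem mass_ofReal_mul {w : ℕ → ℝ} (hw : IsGeneric w) {x : ℝ} (hx : 0 < x) (p : MarkedTree) :
    p.mass w (ENNReal.ofReal x * zetaCrit w) =
      ENNReal.ofReal x ^ (p.tree.body.ncard - 1) * p.mass w (zetaCrit w) := by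
  have hx0 : ENNReal.ofReal x ≠ 0 := (ENNReal.ofReal_pos.2 hx).ne'
  have h0 := (zetaCrit_pos hw).ne'
  have ht := zetaCrit_ne_top hw
  rw [mass_eq hw (mul_ne_zero hx0 h0) (ENNReal.mul_ne_top ENNReal.ofReal_ne_top ht),
    mass_eq hw h0 ht, mul_pow, mul_left_comm]

/-- The tail of the size of a marked tree is bounded by its generating function at the fugacity
`(1 - 1 / n) ζ₀`, which the square root bound controls. -/
theorem exists_tsum_mass_le {w : ℕ → ℝ} (hw : IsGeneric w) {ν : Measure PlanarTree}
    (hν : IsInfiniteVolumeLimit w ν) :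
    ∃ C : ℝ, 0 ≤ C ∧ ∀ K n : ℕ, 2 ≤ n →
      ∑' p : {p : MarkedTree // p.mark.length = K},
        {p : {p : MarkedTree // p.mark.length = K} | n ≤ p.1.tree.body.ncard - 1}.indicator
          (fun p => p.1.mass w (zetaCrit w)) p ≤ ENNReal.ofReal (K * (C / √n)) := by
  obtain ⟨C, hC, hbound⟩ :=
    exists_one_le_mul_branchDerivSum_add hw (zetaCrit_mul_branchDerivSum hw hν)
  refine ⟨2 * C, by positivity, fun K n hn => ?_⟩
  have hn2 : (2 : ℝ) ≤ n := by exact_mod_cast hn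
  have hn0 : (0 : ℝ) < n := by linarith
  set x : ℝ := 1 - 1 / n with hx
  have hx2 : 1 / 2 ≤ x := by
    have : 1 / (n : ℝ) ≤ 1 / 2 := one_div_le_one_div_of_le (by norm_num) hn2
    linarith
  have hx0 : 0 < x := by linarith
  have hx1 : x < 1 := by
    have : 0 < 1 / (n : ℝ) := by positivity
    linarith
  have hxn : x ^ n ≤ 1 / 2 := by
    calc x ^ n ≤ Real.exp (-(1 / n)) ^ n := by
          gcongr
          rw [hx]
          have := Real.add_one_le_exp (-(1 / (n : ℝ)))
          linarith
      _ = (Real.exp 1)⁻¹ := by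
          rw [← Real.exp_nat_mul, ← Real.exp_neg]
          congr 1
          field_simp
      _ ≤ 1 / 2 := by
          rw [one_div]
          have := Real.add_one_le_exp (1 : ℝ)
          gcongr
          linarith
  set X := ENNReal.ofReal x with hX
  have hX1 : X ≤ 1 := ENNReal.ofReal_le_one.2 hx1.le
  have hXn : ∀ m, n ≤ m → X ^ m + 1 / 2 ≤ 1 := by
    intro m hm
    calc X ^ m + 1 / 2 ≤ X ^ n + 1 / 2 := by
          exact add_le_add (pow_le_pow_right_of_le_one' hX1 hm) le_rfl
      _ = ENNReal.ofReal (x ^ n + 1 / 2) := by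
          rw [ENNReal.ofReal_add (by positivity) (by norm_num), ENNReal.ofReal_pow hx0.le,
            ENNReal.ofReal_div_of_pos (by norm_num)]
          simp [hX]
      _ ≤ 1 := ENNReal.ofReal_le_one.2 (by linarith)
  set g := X * zetaCrit w * branchDerivSum w (treeSum w (X * zetaCrit w)) with hg
  have hXζ0 : X * zetaCrit w ≠ 0 :=
    mul_ne_zero (ENNReal.ofReal_pos.2 hx0).ne' (zetaCrit_pos hw).ne'
  have hXζt : X * zetaCrit w ≠ ∞ := ENNReal.mul_ne_top ENNReal.ofReal_ne_top (zetaCrit_ne_top hw)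
  have hgK : ∀ K, ∑' p : {p : MarkedTree // p.mark.length = K},
      X ^ (p.1.tree.body.ncard - 1) * p.1.mass w (zetaCrit w) = g ^ K := by
    intro K
    rw [hg, ← tsum_mass hw hXζ0 hXζt]
    exact tsum_congr fun p => (mass_ofReal_mul hw hx0 p.1).symm
  have hg1 : g ≤ 1 := by
    rw [← pow_one g, ← hgK 1, ← tsum_mass_zetaCrit hw hν 1]
    exact ENNReal.tsum_le_tsum fun p => mul_le_of_le_one_left zero_le (pow_le_one' hX1 _)
  set S := ∑' p : {p : MarkedTree // p.mark.length = K},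
    {p : {p : MarkedTree // p.mark.length = K} | n ≤ p.1.tree.body.ncard - 1}.indicator
      (fun p => p.1.mass w (zetaCrit w)) p with hS
  -- At the fugacity `x ζ₀` the mass of the trees with `|τ| - 1 ≥ n` is at least halved.
  have h₁ : g ^ K + 1 / 2 * S ≤ 1 := by
    refine le_of_le_of_eq ?_ (tsum_mass_zetaCrit hw hν K)
    rw [← hgK K, hS, ← ENNReal.tsum_mul_left, ← ENNReal.tsum_add]
    refine ENNReal.tsum_le_tsum fun p => ?_
    by_cases hp : n ≤ p.1.tree.body.ncard - 1
    · rw [Set.indicator_of_mem (by exact hp), ← add_mul]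
      exact mul_le_of_le_one_left zero_le (hXn _ hp)
    · rw [Set.indicator_of_notMem (by exact hp), mul_zero, add_zero]
      exact mul_le_of_le_one_left zero_le (pow_le_one' hX1 _)
  have h₂ := ENNReal.one_le_pow_add_mul hg1 (hbound x hx2 hx1) K
  have hgt : g ^ K ≠ ∞ := ne_top_of_le_ne_top ENNReal.one_ne_top (pow_le_one' hg1 _)
  have h₃ : 1 / 2 * S ≤ K * ENNReal.ofReal (C * √(1 - x)) :=
    (ENNReal.add_le_add_iff_left hgt).1 (h₁.trans h₂)
  calc S = 2 * (1 / 2 * S) := by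
        rw [← mul_assoc, one_div, ENNReal.mul_inv_cancel (by simp) (by simp), one_mul]
    _ ≤ 2 * (K * ENNReal.ofReal (C * √(1 - x))) := by gcongr
    _ = ENNReal.ofReal (K * (2 * C / √n)) := by
        rw [hx, sub_sub_cancel, one_div, Real.sqrt_inv,
          show (K : ℝ) * (2 * C / √n) = 2 * (K * (C * (√n)⁻¹)) by ring,
          ENNReal.ofReal_mul (p := 2) (by norm_num),
          ENNReal.ofReal_mul (p := (K : ℝ)) (by positivity)]
        simp

end MarkedTree

theorem lemma2 (w : ℕ → ℝ) (hw : PlanarTree.IsGeneric w)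
    (ν : Measure PlanarTree) (hν : PlanarTree.IsInfiniteVolumeLimit w ν) :
    (∀ᵐ T ∂ν, ∃! s : ℕ → T.verts, T.IsSpine s) ∧
    ∃ c : ℝ, 0 < c ∧ ∃ u₀ : ℝ, 0 < u₀ ∧ ∀ K : ℕ, 1 ≤ K → ∀ u : ℝ, u₀ < u →
      ν {T | ∃ s : ℕ → T.verts, T.IsSpine s ∧
          ENNReal.ofReal u ≤ ((K : ℝ≥0∞) ^ 2)⁻¹ * ((T.truncationClosureSize s K : ℕ∞) : ℝ≥0∞)} ≤
        ENNReal.ofReal (c / √u) := by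
  have hae := MarkedTree.ae_exists_mem_completions hw hν
  refine ⟨?_, ?_⟩
  · filter_upwards [hν.ae_infinite hw, hae] with T hT h
    exact PlanarTree.existsUnique_isSpine hT h
  obtain ⟨C, hC, hbound⟩ := MarkedTree.exists_tsum_mass_le hw hν
  refine ⟨√2 * C + 1, by positivity, 4, by norm_num, fun K hK u hu => ?_⟩
  have hK1 : (1 : ℝ) ≤ K := by exact_mod_cast hK
  have hKsq : (1 : ℝ) ≤ (K : ℝ) ^ 2 := one_le_pow₀ hK1
  have huK : 4 < u * (K : ℝ) ^ 2 := by nlinarith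
  -- Passing from `|τ|` to `|τ| - 1` costs at most a factor `2`, as `u K ^ 2 > 4`.
  set y : ℝ := u * (K : ℝ) ^ 2 / 2 with hy
  set n := ⌈y⌉₊ with hn
  have hyn : y ≤ n := Nat.le_ceil y
  have hn2 : 2 ≤ n := by
    have : (2 : ℝ) ≤ n := by linarith
    exact_mod_cast this
  set Q := {p : {p : MarkedTree // p.mark.length = K} | n ≤ p.1.tree.body.ncard - 1} with hQ
  calc ν {T | ∃ s : ℕ → T.verts, T.IsSpine s ∧
          ENNReal.ofReal u ≤ ((K : ℝ≥0∞) ^ 2)⁻¹ * ((T.truncationClosureSize s K : ℕ∞) : ℝ≥0∞)}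
      ≤ ν (⋃ p ∈ Q, p.1.completions) := by
        refine measure_mono_ae ?_
        filter_upwards [hae] with T hT
        rintro ⟨s, hs, hle⟩
        obtain ⟨p, hpK, hp⟩ := hT K
        refine Set.mem_biUnion (x := ⟨p, hpK⟩) ?_ hp
        have h₁ := PlanarTree.truncationClosureSize_le hs hp
        rw [hpK, PlanarTree.size_eq, ← p.finite.cast_ncard_eq] at h₁
        have h₂ : ENNReal.ofReal u ≤ ((K : ℝ≥0∞) ^ 2)⁻¹ * (p.tree.body.ncard : ℝ≥0∞) := by
          refine hle.trans ?_
          gcongr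
          exact_mod_cast h₁
        have hK0 : (K : ℝ≥0∞) ^ 2 ≠ 0 := by
          have : K ≠ 0 := by omega
          positivity
        replace h₂ : (K : ℝ≥0∞) ^ 2 * ENNReal.ofReal u ≤ p.tree.body.ncard := by
          calc _ ≤ (K : ℝ≥0∞) ^ 2 * (((K : ℝ≥0∞) ^ 2)⁻¹ * (p.tree.body.ncard : ℝ≥0∞)) := by gcongr
            _ = _ := ENNReal.mul_inv_cancel_left hK0 (by finiteness)
        have h₃ : (K : ℝ) ^ 2 * u ≤ p.tree.body.ncard := by
          have := ENNReal.toReal_mono (by finiteness) h₂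
          simpa [ENNReal.toReal_ofReal (by linarith : (0 : ℝ) ≤ u)] using this
        change n ≤ p.tree.body.ncard - 1
        rw [hn, Nat.ceil_le, Nat.cast_sub p.ncard_body_pos]
        push_cast
        linarith
    _ ≤ ∑' p : Q, ν p.1.1.completions := measure_biUnion_le ν Q.to_countable _
    _ = ∑' p, Q.indicator (fun p => p.1.mass w (PlanarTree.zetaCrit w)) p := by
        rw [tsum_subtype Q fun p => ν p.1.completions]
        simp_rw [MarkedTree.measure_completions hw hν]
    _ ≤ ENNReal.ofReal (K * (C / √n)) := hbound K n hn2
    _ ≤ ENNReal.ofReal ((√2 * C + 1) / √u) := by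
        refine ENNReal.ofReal_le_ofReal ?_
        have hu0 : 0 < √u := Real.sqrt_pos.2 (by linarith)
        have hsy : √y = √u * K / √2 := by
          rw [hy, Real.sqrt_div (by positivity), Real.sqrt_mul (by linarith),
            Real.sqrt_sq (by positivity)]
        have hsy0 : 0 < √y := Real.sqrt_pos.2 (by linarith)
        calc (K : ℝ) * (C / √n) ≤ K * (C / √y) := by gcongr
          _ = √2 * C / √u := by
              rw [hsy]
              have : (K : ℝ) ≠ 0 := by positivity
              field_simp
          _ ≤ _ := by gcongr; linarith
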